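/- Let $\Sigma_x\in\mathbb{R}^{p\times p}$ be symmetric positive definite and let the state be $x\sim N(0,\Sigma_x)$. For $i\in\{1,2,r\}$ let $Q_i\in\mathbb{R}^{q\times p}$, $R_i\in\mathbb{R}^{q\times t}$, with $R_r^\top R_r$ invertible. A sender policy is a Borel measurable map $\eta:\mathbb{R}^p\to\mathbb{R}^p$, whose signal is $y=\eta(x)$; the receiver sees the signals of the senders present and chooses an action $u\in\mathbb{R}^t$ as a Borel measurable function $\gamma$ of them. Sender 1, sender 2 and the receiver have the expected costs $J_i=\mathbb{E}\|Q_ix+R_iu\|^2$, $i=1,2,r$. The receiver's reaction $\gamma^*$ assigns to every announced policy (or pair of policies) a minimizer of $J_r$. The posterior covariance of signals $y$ is $\mathbb{E}[\hat x\hat x^\top]$ with $\hat x=\mathbb{E}[x\mid y]$. Write $M^{1/2}$ for the positive semidefinite square root, $M^\dagger$ for the Moore–Penrose inverse and $M^{\dagger 1/2}=(M^{1/2})^\dagger$. For $i=1,2$ put $V_i=\Lambda_i^\top\Lambda_i-\Lambda_i^\top Q_i-Q_i^\top\Lambda_i$ with $\Lambda_i=R_i(R_r^\top R_r)^{-1}R_r^\top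 Q_r$. *Base game.* With sender 1 alone, an equilibrium is a policy $\eta_1$ minimizing $J_1(\eta,\gamma^*(\eta))$ over all sender policies $\eta$; among policies of equal, minimal cost, sender 1 takes one whose posterior covariance has least rank. Let $\Sigma_1^*$ be the posterior covariance of such an equilibrium. *Algorithm.* For a symmetric matrix $W$ let $P^-(W)=Q(Q^\top Q)^{-1}Q^\top$, where the columns of $Q$ are a full set of linearly independent eigenvectors of $W$ for its negative eigenvalues. Put $$S_1=\Sigma_x^{1/2}P^-\big(\Sigma_x^{1/2}V_1\Sigma_x^{1/2}\big)\Sigma_x^{1/2},\qquad \Sigma^*=S_1+D^{1/2}P^-\big(D^{1/2}V_2D^{1/2}\big)D^{1/2},\quad D=\Sigma_x-S_1 .$$ *Theorem.* The algorithm can be run, and its output $\Sigma^*$ is stable for both senders: for $i=1,2$, $0\preceq\Sigma^*\preceq\Sigma_x$ and $\operatorname{Tr}(V_i\Sigma^*)=\min_{\Sigma_x\succeq S\succeq\Sigma^*}\operatorname{Tr}(V_iS)$. The base game has linear equilibria: if $\Sigma_x^{-1/2}S_1\Sigma_x^{-1/2}=U_1\Lambda_1U_1^\top$ with $U_1$ orthogonal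 and $\Lambda_1$ diagonal, then $x\mapsto Ax$ with $A^\top=\Sigma_x^{-1/2}U_1\Lambda_1$ is one. For every equilibrium $\eta_1$ of the base game, $\Sigma_1^*=S_1$; the matrix $$\tilde P_2=(\Sigma_x-\Sigma_1^*)^{\dagger 1/2}(\Sigma^*-\Sigma_1^*)(\Sigma_x-\Sigma_1^*)^{\dagger 1/2}$$ is an orthogonal projection, and $\Sigma^*=\Sigma_1^*+(\Sigma_x-\Sigma_1^*)^{1/2}\tilde P_2(\Sigma_x-\Sigma_1^*)^{1/2}$; and after commitment to $\eta_1$ the receiver has a best response to every policy of sender 2. Suppose moreover that sender 1, not knowing of sender 2, has committed to a linear equilibrium policy $\eta_1(x)=Ax$ of the base game, and that sender 2 then enters. Let $\tilde P_2=U_2^*\Lambda_2^*U_2^{*\top}$ with $U_2^*$ orthogonal and $\Lambda_2^*$ diagonal, and let $\eta_2^*(x)=Bx$ with $B^\top=(\Sigma_x-\Sigma_1^*)^{\dagger 1/2}U_2^*\Lambda_2^*$. Then, for every reaction $\gamma^*$ of the receiver, $(\eta_2^*,\gamma^*)$ is a Stackelberg equilibrium given $\eta_1$, that is, $\eta_2^*$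 minimizes $J_2(\eta_1,\eta_2,\gamma^*(\eta_1,\eta_2))$ over all Borel measurable policies $\eta_2$; and the posterior covariance of the two signals $(Ax,Bx)$ is $\Sigma^*$. -/

import Mathlib

open MeasureTheory ProbabilityTheory Matrix
open scoped ENNReal

namespace SenderGame

/-- `ℝⁿ` with its Euclidean norm. -/
abbrev E (n : ℕ) : Type := EuclideanSpace ℝ (Fin n)

/-! ### Square roots and pseudo-inverses of symmetric matrices -/

/-- The positive semidefinite square root `M^{1/2}` of a positive semidefinite matrix: the square
roots of the eigenvalues are taken in the spectral decomposition. -/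
noncomputable def psdSqrt {p : ℕ} (M : Matrix (Fin p) (Fin p) ℝ) : Matrix (Fin p) (Fin p) ℝ :=
  cfc Real.sqrt M

/-- The Moore-Penrose pseudo-inverse `M†` of a symmetric matrix: the nonzero eigenvalues are
inverted in the spectral decomposition, and the zero eigenvalues are kept (`0⁻¹ = 0`). -/
noncomputable def symPinv {p : ℕ} (M : Matrix (Fin p) (Fin p) ℝ) : Matrix (Fin p) (Fin p) ℝ :=
  cfc (fun t : ℝ => t⁻¹) M

/-! ### The game -/

/-- The state is `x ∼ N(0, Sx)`; this is its law. -/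
noncomputable def stateLaw {p : ℕ} (Sx : Matrix (Fin p) (Fin p) ℝ) : Measure (E p) :=
  multivariateGaussian 0 Sx

/-- The linear signaling policy `x ↦ A x`. -/
noncomputable def linearPolicy {p : ℕ} (A : Matrix (Fin p) (Fin p) ℝ) : E p → E p :=
  fun x => Matrix.toEuclideanLin A x

/-- Expected quadratic cost `𝔼 ‖Q x + R u‖²`, with values in `[0, ∞]`, when the receiver observes
`y x` and takes the action `u = γ (y x)`. -/
noncomputable def expectedCost {p q t : ℕ} {Y : Type*} (Sx : Matrix (Fin p) (Fin p) ℝ)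
    (Q : Matrix (Fin q) (Fin p) ℝ) (R : Matrix (Fin q) (Fin t) ℝ)
    (y : E p → Y) (γ : Y → E t) : ℝ≥0∞ :=
  ∫⁻ x, ‖Matrix.toEuclideanLin Q x + Matrix.toEuclideanLin R (γ (y x))‖ₑ ^ 2 ∂(stateLaw Sx)

/-- `γ` is a best response, among all Borel measurable policies, of a receiver with cost matrices
`Qr`, `Rr` who observes `y x`. -/
structure IsBestResponse {p q t : ℕ} {Y : Type*} [MeasurableSpace Y]
    (Sx : Matrix (Fin p) (Fin p) ℝ) (Qr : Matrix (Fin q) (Fin p) ℝ) (Rr : Matrix (Fin q) (Fin t) ℝ)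
    (y : E p → Y) (γ : Y → E t) : Prop where
  measurable : Measurable γ
  optimal : ∀ γ' : Y → E t, Measurable γ' →
    expectedCost Sx Qr Rr y γ ≤ expectedCost Sx Qr Rr y γ'

/-- `γ` is a reaction of the receiver to an announced policy of the sender that is currently
choosing: `obs η` is what the receiver observes if that sender chooses `η`, and `γ η` has to be a
best response to it, for every Borel measurable `η`. -/
def IsReceiverReaction {p q t : ℕ} {Y : Type*} [MeasurableSpace Y]
    (Sx : Matrix (Fin p) (Fin p) ℝ) (Qr : Matrix (Fin q) (Fin p) ℝ) (Rr : Matrix (Fin q) (Fin t) ℝ)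
    (obs : (E p → E p) → E p → Y) (γ : (E p → E p) → Y → E t) : Prop :=
  ∀ η : E p → E p, Measurable η → IsBestResponse Sx Qr Rr (obs η) (γ η)

/-- `(η, γ)` is a Stackelberg equilibrium between a sender with cost matrices `Q`, `R`, who leads
and may choose any Borel measurable policy, and a receiver with cost matrices `Qr`, `Rr`. -/
structure IsStackelberg {p q t : ℕ} {Y : Type*} [MeasurableSpace Y]
    (Sx : Matrix (Fin p) (Fin p) ℝ) (Q : Matrix (Fin q) (Fin p) ℝ) (R : Matrix (Fin q) (Fin t) ℝ)
    (Qr : Matrix (Fin q) (Fin p) ℝ) (Rr : Matrix (Fin q) (Fin t) ℝ)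
    (obs : (E p → E p) → E p → Y) (η : E p → E p) (γ : (E p → E p) → Y → E t) : Prop where
  measurable : Measurable η
  reaction : IsReceiverReaction Sx Qr Rr obs γ
  optimal : ∀ η' : E p → E p, Measurable η' →
    expectedCost Sx Q R (obs η) (γ η) ≤ expectedCost Sx Q R (obs η') (γ η')

/-- Observation in the base game, with one sender: its signal. -/
def obsSingle {p : ℕ} (η : E p → E p) : E p → E p := η

/-- Observation after a first sender has committed to `η₁`: the pair of signals. -/
def obsAfter {p : ℕ} (η₁ η : E p → E p) : E p → E p × E p := fun x => (η₁ x, η x)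

/-- The posterior estimate `𝔼[x | y]`. -/
noncomputable def posteriorMean {p : ℕ} {Y : Type*} [MeasurableSpace Y]
    (Sx : Matrix (Fin p) (Fin p) ℝ) (y : E p → Y) : E p → E p :=
  (stateLaw Sx)[fun x : E p => x | MeasurableSpace.comap y inferInstance]

/-- The posterior covariance `𝔼[x̂ x̂ᵀ]` with `x̂ = 𝔼[x | y]`. -/
noncomputable def posteriorCov {p : ℕ} {Y : Type*} [MeasurableSpace Y]
    (Sx : Matrix (Fin p) (Fin p) ℝ) (y : E p → Y) : Matrix (Fin p) (Fin p) ℝ :=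
  Matrix.of fun i j => ∫ x, posteriorMean Sx y x i * posteriorMean Sx y x j ∂(stateLaw Sx)

/-- Equilibrium of the base game with one sender, with the convention that among policies of equal
cost the sender takes one that reveals only what is needed: the posterior covariance has the least
rank among all equilibrium policies. -/
structure IsBaseEquilibrium {p q t : ℕ}
    (Sx : Matrix (Fin p) (Fin p) ℝ) (Q : Matrix (Fin q) (Fin p) ℝ) (R : Matrix (Fin q) (Fin t) ℝ)
    (Qr : Matrix (Fin q) (Fin p) ℝ) (Rr : Matrix (Fin q) (Fin t) ℝ)
    (η : E p → E p) (γ : (E p → E p) → E p → E t) : Prop where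
  stackelberg : IsStackelberg Sx Q R Qr Rr obsSingle η γ
  least_rank : ∀ η' : E p → E p, IsStackelberg Sx Q R Qr Rr obsSingle η' γ →
    (posteriorCov Sx η).rank ≤ (posteriorCov Sx η').rank

/-! ### The trace objectives, stability, and the algorithm -/

/-- `V = ΛᵀΛ - ΛᵀQ - QᵀΛ` with `Λ = R (RrᵀRr)⁻¹ Rrᵀ Qr`. -/
noncomputable def costMatrix {p q t : ℕ} (Q : Matrix (Fin q) (Fin p) ℝ)
    (R : Matrix (Fin q) (Fin t) ℝ) (Qr : Matrix (Fin q) (Fin p) ℝ)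
    (Rr : Matrix (Fin q) (Fin t) ℝ) : Matrix (Fin p) (Fin p) ℝ :=
  let L := R * (Rrᵀ * Rr)⁻¹ * Rrᵀ * Qr
  Lᵀ * L - Lᵀ * Q - Qᵀ * L

/-- `S` is stable for a sender with trace objective `V`: `S` attains the minimum of `Tr(V T)` over
`Sx ⪰ T ⪰ S ⪰ 0`. -/
structure IsStable {p : ℕ} (Sx V S : Matrix (Fin p) (Fin p) ℝ) : Prop where
  nonneg : S.PosSemidef
  le_prior : (Sx - S).PosSemidef
  minimal : ∀ T : Matrix (Fin p) (Fin p) ℝ, (Sx - T).PosSemidef → (T - S).PosSemidef →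
    (V * S).trace ≤ (V * T).trace

/-- The columns of `Q` are a full set of linearly independent eigenvectors of `W` for its negative
eigenvalues. -/
structure IsNegEigenbasis {p r : ℕ} (W : Matrix (Fin p) (Fin p) ℝ)
    (Q : Matrix (Fin p) (Fin r) ℝ) : Prop where
  indep : LinearIndependent ℝ (fun j : Fin r => Q.col j)
  eigen : ∀ j : Fin r, ∃ c : ℝ, c < 0 ∧ W *ᵥ Q.col j = c • Q.col j
  complete : ∀ (c : ℝ) (v : Fin p → ℝ), c < 0 → W *ᵥ v = c • v →
    v ∈ Submodule.span ℝ (Set.range fun j : Fin r => Q.col j)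

/-- One step of the algorithm, from the posterior `S` to the posterior `S'`: with
`W = (Sx - S)^{1/2} V (Sx - S)^{1/2}`, `Q` the matrix of eigenvectors of its negative eigenvalues
and `P = Q (QᵀQ)⁻¹ Qᵀ`, put `S' = S + (Sx - S)^{1/2} P (Sx - S)^{1/2}`. -/
def AlgorithmStep {p : ℕ} (Sx V S S' : Matrix (Fin p) (Fin p) ℝ) : Prop :=
  ∃ (r : ℕ) (Q : Matrix (Fin p) (Fin r) ℝ),
    IsNegEigenbasis (psdSqrt (Sx - S) * V * psdSqrt (Sx - S)) Q ∧
    S' = S + psdSqrt (Sx - S) * (Q * (Qᵀ * Q)⁻¹ * Qᵀ) * psdSqrt (Sx - S)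

/-- A run of the algorithm: a step for sender 1 from the zero posterior to `S₁`, then a step for
sender 2 from `S₁` to the output `S`. -/
def AlgorithmRun {p : ℕ} (Sx V₁ V₂ S₁ S : Matrix (Fin p) (Fin p) ℝ) : Prop :=
  AlgorithmStep Sx V₁ 0 S₁ ∧ AlgorithmStep Sx V₂ S₁ S

end SenderGame

/-! Against a best response the receiver's action is almost surely `-K x̂` with `K = gain Qr Rr`, so
a sender's cost is a constant plus Tr(V C), where C is the posterior covariance
(`IsBestResponse.expectedCost_eq`). The game thus becomes a matrix problem. Every policy has 0 ⪯ C ⪯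
Σ, and once sender 1 has committed, C also dominates the first posterior (`posteriorCov_le`,
`posteriorCov_mono`). Minimizing Tr(V T) over S ⪯ T ⪯ Σ is therefore a relaxation of each sender's
problem.

With H = (Σ - S)^{1/2} and G = H†, the increment is T - S = H X H with 0 ⪯ X ⪯ 1. The objective
becomes Tr(W X) with W = H V H, and the projection P on the negative eigenspaces of W minimizes it
(`IsNegProj.trace_le`). So a step of the algorithm solves the relaxation. The relaxation is tight,
since the linear signal Uᵀ P G x attains S + H P H. Uncorrelated jointly Gaussian vectors are
independent, so this is an orthogonality computation (`posteriorCov_first`, `posteriorCov_after`).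

Every minimizer X satisfies P X = P, hence has rank at least that of P, with equality only for X =
P. The least rank convention therefore forces the base posterior, also for nonlinear equilibria.
Sender 1 stays content after the second step because anything still unrevealed, once compressed, is
orthogonal to P and so lies where W is nonnegative (`StepData.trace_nonneg`). -/

namespace SenderGame

/-! ### Positive semidefinite matrices: square roots, pseudo-inverses, traces. -/

section MatrixLemmas

variable {p m : ℕ}

/-- A symmetric real matrix is orthogonally diagonalizable, and the functional calculus acts on the
eigenvalues. -/
lemma exists_diagonalization {M : Matrix (Fin p) (Fin p) ℝ} (hM : M.IsHermitian) :
    ∃ (U : Matrix (Fin p) (Fin p) ℝ) (w : Fin p → ℝ), Uᵀ * U = 1 ∧ U * Uᵀ = 1 ∧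
      M = U * diagonal w * Uᵀ ∧ (M.PosSemidef → ∀ i, 0 ≤ w i) ∧
      ∀ f : ℝ → ℝ, cfc f M = U * diagonal (fun i => f (w i)) * Uᵀ := by
  refine ⟨hM.eigenvectorUnitary, hM.eigenvalues, ?_, ?_, ?_, fun h => h.eigenvalues_nonneg, ?_⟩
  · have := Unitary.coe_star_mul_self hM.eigenvectorUnitary
    rwa [star_eq_conjTranspose, conjTranspose_eq_transpose_of_trivial] at this
  · have := Unitary.coe_mul_star_self hM.eigenvectorUnitary
    rwa [Unitary.coe_star, star_eq_conjTranspose, conjTranspose_eq_transpose_of_trivial] at this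
  · have := hM.spectral_theorem
    rw [Unitary.conjStarAlgAut_apply, star_eq_conjTranspose,
      conjTranspose_eq_transpose_of_trivial] at this
    exact this
  · intro f
    rw [hM.cfc_eq, IsHermitian.cfc, Unitary.conjStarAlgAut_apply, star_eq_conjTranspose,
      conjTranspose_eq_transpose_of_trivial]
    rfl

lemma conj_diagonal_mul {U : Matrix (Fin p) (Fin p) ℝ} (hU : Uᵀ * U = 1) (a b : Fin p → ℝ) :
    U * diagonal a * Uᵀ * (U * diagonal b * Uᵀ) = U * diagonal (fun i => a i * b i) * Uᵀ := by
  rw [show U * diagonal a * Uᵀ * (U * diagonal b * Uᵀ)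
      = U * diagonal a * (Uᵀ * U) * diagonal b * Uᵀ by simp only [Matrix.mul_assoc], hU,
    Matrix.mul_one, Matrix.mul_assoc U, diagonal_mul_diagonal]

lemma conj_diagonal_transpose (U : Matrix (Fin p) (Fin p) ℝ) (a : Fin p → ℝ) :
    (U * diagonal a * Uᵀ)ᵀ = U * diagonal a * Uᵀ := by
  simp [transpose_mul, Matrix.mul_assoc]

lemma posSemidef_conj {M : Matrix (Fin p) (Fin p) ℝ} (hM : M.PosSemidef)
    (X : Matrix (Fin m) (Fin p) ℝ) : (X * M * Xᵀ).PosSemidef := by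
  simpa using hM.mul_mul_conjTranspose_same X

lemma posSemidef_conj_diagonal (U : Matrix (Fin p) (Fin p) ℝ) {a : Fin p → ℝ}
    (ha : ∀ i, 0 ≤ a i) : (U * diagonal a * Uᵀ).PosSemidef :=
  posSemidef_conj (PosSemidef.diagonal ha) U

lemma PosSemidef.symm {M : Matrix (Fin p) (Fin p) ℝ} (hM : M.PosSemidef) : Mᵀ = M := by
  simpa [IsHermitian] using hM.isHermitian

/-- The algebraic relations between the square root `H` of `M` and the pseudo-inverse `G` of `H`. -/
structure IsRootPair (M H G : Matrix (Fin p) (Fin p) ℝ) : Prop where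
  symm : Hᵀ = H
  symm' : Gᵀ = G
  sq : H * H = M
  comm : H * G = G * H
  left : H * G * H = H
  right : G * H * G = G

lemma isRootPair {M : Matrix (Fin p) (Fin p) ℝ} (hM : M.PosSemidef) :
    IsRootPair M (psdSqrt M) (symPinv (psdSqrt M)) := by
  obtain ⟨U, w, hU, hU', hMU, hw, hf⟩ := exists_diagonalization hM.isHermitian
  have hH : psdSqrt M = U * diagonal (fun i => √(w i)) * Uᵀ := hf Real.sqrt
  have hHs : (psdSqrt M).IsHermitian := by
    rw [IsHermitian, conjTranspose_eq_transpose_of_trivial, hH, conj_diagonal_transpose]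
  have hG : symPinv (psdSqrt M) = U * diagonal (fun i => (√(w i))⁻¹) * Uᵀ := by
    have hc : symPinv (psdSqrt M) = cfc (fun t : ℝ => t⁻¹) (cfc Real.sqrt M) := rfl
    -- Inversion is discontinuous at 0, but on a finite spectrum every function is continuous, so
    -- the functional calculus composes.
    have hfin := M.finite_real_spectrum
    rw [hc, ← cfc_comp' (fun t : ℝ => t⁻¹) Real.sqrt M
      ((hfin.image _).continuousOn _) (hfin.continuousOn _) hM.isHermitian.isSelfAdjoint]
    exact hf fun t => (√t)⁻¹
  rw [hH] at *
  constructor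
  · exact conj_diagonal_transpose _ _
  · rw [hG]; exact conj_diagonal_transpose _ _
  · rw [conj_diagonal_mul hU, hMU]
    simp only [Real.mul_self_sqrt (hw hM _)]
  · rw [hG, conj_diagonal_mul hU, conj_diagonal_mul hU]; simp only [mul_comm]
  · rw [hG, conj_diagonal_mul hU, conj_diagonal_mul hU]; simp only [mul_inv_mul_cancel]
  · rw [hG, conj_diagonal_mul hU, conj_diagonal_mul hU]
    congr; ext i
    rcases eq_or_ne (√(w i)) 0 with h | h <;> simp [h]

lemma exists_transpose_mul_self {M : Matrix (Fin p) (Fin p) ℝ} (hM : M.PosSemidef) :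
    ∃ X : Matrix (Fin p) (Fin p) ℝ, M = Xᵀ * X :=
  ⟨psdSqrt M, by rw [(isRootPair hM).symm, (isRootPair hM).sq]⟩

lemma posSemidef_transpose_mul_self (X : Matrix (Fin m) (Fin p) ℝ) : (Xᵀ * X).PosSemidef := by
  simpa using posSemidef_conjTranspose_mul_self X

lemma trace_mul_nonneg {M N : Matrix (Fin p) (Fin p) ℝ} (hM : M.PosSemidef) (hN : N.PosSemidef) :
    0 ≤ (M * N).trace := by
  obtain ⟨X, rfl⟩ := exists_transpose_mul_self hN
  rw [← Matrix.mul_assoc, trace_mul_comm, ← Matrix.mul_assoc]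
  exact (posSemidef_conj hM X).trace_nonneg

/-- For M = YᵀY and N = XᵀX the trace is the squared Frobenius norm of Y Xᵀ. -/
lemma mul_eq_zero_of_trace {M N : Matrix (Fin p) (Fin p) ℝ} (hM : M.PosSemidef)
    (hN : N.PosSemidef) (h : (M * N).trace = 0) : M * N = 0 := by
  obtain ⟨X, rfl⟩ := exists_transpose_mul_self hN
  obtain ⟨Y, rfl⟩ := exists_transpose_mul_self hM
  have h0 : (Y * Xᵀ)ᴴ * (Y * Xᵀ) = X * Yᵀ * Y * Xᵀ := by
    simp [transpose_mul, Matrix.mul_assoc]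
  have : Y * Xᵀ = 0 := by
    rw [← trace_conjTranspose_mul_self_eq_zero_iff, h0, ← h, trace_mul_comm,
      ← trace_mul_comm (Xᵀ * X)]
    simp only [Matrix.mul_assoc]
  rw [Matrix.mul_assoc, ← Matrix.mul_assoc Y, this]; simp

/-- Order reverses kernels. On the columns of K the form D vanishes, so both KᵀNK and its negative
are positive semidefinite. -/
lemma mul_eq_zero_of_le {D N : Matrix (Fin p) (Fin p) ℝ} (hN : N.PosSemidef)
    (hDN : (D - N).PosSemidef) {K : Matrix (Fin p) (Fin p) ℝ} (hK : D * K = 0) : N * K = 0 := by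
  have h1 : (Kᵀ * N * K).PosSemidef := by simpa using posSemidef_conj hN Kᵀ
  have h2 : (Kᵀ * (D - N) * K).PosSemidef := by simpa using posSemidef_conj hDN Kᵀ
  have h3 : Kᵀ * (D - N) * K = -(Kᵀ * N * K) := by
    rw [Matrix.mul_sub, Matrix.sub_mul, Matrix.mul_assoc Kᵀ D, hK]; simp
  obtain ⟨X, hX⟩ := exists_transpose_mul_self hN
  have h4 : (Kᵀ * N * K).trace = 0 := by
    have a := h1.trace_nonneg
    have b := h2.trace_nonneg
    rw [h3, trace_neg] at b
    linarith
  have h5 : X * K = 0 := by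
    rw [← trace_conjTranspose_mul_self_eq_zero_iff, ← h4, hX]
    simp [transpose_mul, Matrix.mul_assoc]
  rw [hX, Matrix.mul_assoc, h5, Matrix.mul_zero]

/-- If `0 ≤ N ≤ M` then `N` is unchanged by compression to the range of `M`. -/
lemma IsRootPair.compress {M H G N : Matrix (Fin p) (Fin p) ℝ} (h : IsRootPair M H G)
    (hN : N.PosSemidef) (hMN : (M - N).PosSemidef) : H * (G * N * G) * H = N := by
  have h1 : M * (1 - G * H) = 0 := by
    rw [← h.sq, Matrix.mul_sub, Matrix.mul_one, Matrix.mul_assoc, ← Matrix.mul_assoc H G H, h.left,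
      sub_self]
  have h2 : N * (G * H) = N := by
    have := mul_eq_zero_of_le hN hMN h1
    rw [Matrix.mul_sub, Matrix.mul_one, sub_eq_zero] at this
    exact this.symm
  have h3 : H * G * N = N := by
    have := congrArg transpose h2
    rwa [transpose_mul, transpose_mul, h.symm, h.symm', PosSemidef.symm hN] at this
  calc H * (G * N * G) * H = H * G * (N * (G * H)) := by simp only [Matrix.mul_assoc]
    _ = N := by rw [h2, h3]

lemma IsRootPair.compress_posSemidef {M H G N : Matrix (Fin p) (Fin p) ℝ} (h : IsRootPair M H G)
    (hN : N.PosSemidef) : (G * N * G).PosSemidef := by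
  simpa [h.symm'] using posSemidef_conj hN G

lemma posSemidef_of_idem {P : Matrix (Fin p) (Fin p) ℝ} (h : Pᵀ = P) (h' : P * P = P) :
    P.PosSemidef := by
  have := posSemidef_transpose_mul_self P
  rwa [h, h'] at this

lemma posSemidef_one_sub {P : Matrix (Fin p) (Fin p) ℝ} (h : Pᵀ = P) (h' : P * P = P) :
    (1 - P).PosSemidef :=
  posSemidef_of_idem (by simp [h]) (by simp [Matrix.mul_sub, Matrix.sub_mul, h'])

/-- Since G M G = H G is the projection on the range of M, the matrix splits as (1 - H G) + G (M -
N) G. -/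
lemma IsRootPair.one_sub_compress {M H G N : Matrix (Fin p) (Fin p) ℝ} (h : IsRootPair M H G)
    (hMN : (M - N).PosSemidef) : (1 - G * N * G).PosSemidef := by
  have h1 : G * M * G = H * G := by
    rw [← h.sq, ← Matrix.mul_assoc, Matrix.mul_assoc, ← h.comm, ← Matrix.mul_assoc, h.left]
  have h2 : (1 - H * G).PosSemidef := posSemidef_one_sub
    (by rw [transpose_mul, h.symm, h.symm', h.comm]) (by rw [← Matrix.mul_assoc, h.left])
  have h3 := h2.add (h.compress_posSemidef hMN)
  rw [Matrix.mul_sub, Matrix.sub_mul, h1] at h3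
  convert h3 using 1
  abel

/-! ### The projection on the negative eigenspaces -/

/-- `P` is the orthogonal projection on the span of the eigenvectors of `W` for its negative
eigenvalues. -/
structure IsNegProj (W P : Matrix (Fin p) (Fin p) ℝ) : Prop where
  symm : Pᵀ = P
  idem : P * P = P
  neg : (-(W * P)).PosSemidef
  pos : (W * (1 - P)).PosSemidef
  factor : ∃ Y, P = Y * W

lemma IsNegProj.factor' {W P : Matrix (Fin p) (Fin p) ℝ} (h : IsNegProj W P) (hW : Wᵀ = W) :
    ∃ Y, P = W * Y := by
  obtain ⟨Y, hY⟩ := h.factor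
  refine ⟨Yᵀ, ?_⟩
  rw [← h.symm, hY, transpose_mul, hW]

/-- An orthonormal eigenbasis supplies a reference projection. The clauses on fixed vectors and on
spans are what is needed to compare it with an arbitrary, possibly non-orthogonal, eigenbasis. -/
lemma exists_negProj {W : Matrix (Fin p) (Fin p) ℝ} (hW : Wᵀ = W) :
    ∃ P : Matrix (Fin p) (Fin p) ℝ, IsNegProj W P ∧
      (∀ (c : ℝ) (v : Fin p → ℝ), c < 0 → W *ᵥ v = c • v → P *ᵥ v = v) ∧
      (∀ {r : ℕ} (Q : Matrix (Fin p) (Fin r) ℝ), IsNegEigenbasis W Q →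
        ∀ v, P *ᵥ v ∈ Submodule.span ℝ (Set.range fun j : Fin r => Q.col j)) ∧
      ∃ (r : ℕ) (Q : Matrix (Fin p) (Fin r) ℝ), IsNegEigenbasis W Q := by
  have hWh : W.IsHermitian := by rwa [IsHermitian, conjTranspose_eq_transpose_of_trivial]
  obtain ⟨U, w, hU, hU', hWU, -, -⟩ := exists_diagonalization hWh
  set e : Fin p → ℝ := fun i => if w i < 0 then 1 else 0 with he
  have hcol : ∀ j, W *ᵥ U.col j = w j • U.col j := by
    intro j
    have h1 : W * U = U * diagonal w := by rw [hWU, Matrix.mul_assoc, hU, Matrix.mul_one]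
    ext i
    have := congrFun (congrFun h1 i) j
    rw [mul_diagonal] at this
    simpa [Matrix.mul_apply, mulVec, dotProduct, mul_comm] using this
  have hexp : ∀ (d : Fin p → ℝ) (v : Fin p → ℝ),
      (U * diagonal d) *ᵥ v = ∑ j, (d j * v j) • U.col j := by
    intro d v
    ext i
    simp [mulVec, dotProduct, mul_diagonal, Finset.sum_apply]
    exact Finset.sum_congr rfl fun j _ => by ring
  -- An eigenvector for c has no component along eigenvectors with another eigenvalue.
  have hsupp : ∀ (c : ℝ) (v : Fin p → ℝ), W *ᵥ v = c • v →
      ∀ j, w j ≠ c → (Uᵀ *ᵥ v) j = 0 := by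
    intro c v hv j hj
    have h1 : diagonal w *ᵥ (Uᵀ *ᵥ v) = c • (Uᵀ *ᵥ v) := by
      rw [← mulVec_smul, ← hv, hWU, mulVec_mulVec, mulVec_mulVec, Matrix.mul_assoc,
        ← Matrix.mul_assoc Uᵀ, hU, Matrix.one_mul]
    have h2 := congrFun h1 j
    rw [mulVec_diagonal, Pi.smul_apply, smul_eq_mul] at h2
    have h3 : (w j - c) * (Uᵀ *ᵥ v) j = 0 := by rw [sub_mul, h2, sub_self]
    exact (mul_eq_zero.mp h3).resolve_left (sub_ne_zero.mpr hj)
  have hfix : ∀ v : Fin p → ℝ, v = ∑ j, (Uᵀ *ᵥ v) j • U.col j := by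
    intro v
    have := hexp 1 (Uᵀ *ᵥ v)
    simp only [Pi.one_apply, one_mul] at this
    rw [← this, show diagonal (1 : Fin p → ℝ) = 1 from diagonal_one, Matrix.mul_one,
      mulVec_mulVec, hU', one_mulVec]
  refine ⟨U * diagonal e * Uᵀ, ⟨conj_diagonal_transpose _ _, ?_, ?_, ?_, ?_⟩, ?_, ?_, ?_⟩
  · rw [conj_diagonal_mul hU]; congr; ext i; simp [he]
  · rw [hWU, conj_diagonal_mul hU, ← Matrix.neg_mul, ← Matrix.mul_neg, diagonal_neg]
    refine posSemidef_conj_diagonal U fun i => ?_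
    by_cases h : w i < 0 <;> simp [he, h]
    exact h.le
  · have h1 : (1 : Matrix (Fin p) (Fin p) ℝ) - U * diagonal e * Uᵀ
        = U * diagonal (fun i => 1 - e i) * Uᵀ := by
      have : diagonal (fun i => 1 - e i) = 1 - diagonal e := by
        rw [← diagonal_one, diagonal_sub]
      rw [this, Matrix.mul_sub, Matrix.sub_mul, Matrix.mul_one, hU']
    rw [h1, hWU, conj_diagonal_mul hU]
    refine posSemidef_conj_diagonal U fun i => ?_
    by_cases h : w i < 0 <;> simp [he, h]
    exact not_lt.mp h
  · refine ⟨U * diagonal (fun i => e i * (w i)⁻¹) * Uᵀ, ?_⟩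
    rw [hWU, conj_diagonal_mul hU]; congr; ext i
    by_cases h : w i < 0 <;> simp [he, h]
    exact (inv_mul_cancel₀ h.ne).symm
  · intro c v hc hv
    conv_rhs => rw [hfix v]
    rw [← mulVec_mulVec, hexp]
    refine Finset.sum_congr rfl fun j _ => ?_
    by_cases h : w j = c
    · simp [he, h, hc]
    · simp [hsupp c v hv j h]
  · intro r Q hQ v
    rw [← mulVec_mulVec, hexp]
    refine Submodule.sum_mem _ fun j _ => ?_
    by_cases h : w j < 0
    · exact Submodule.smul_mem _ _ (hQ.complete (w j) _ h (hcol j))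
    · simp [he, h]
  · let ι := {i : Fin p // w i < 0}
    let f := (Fintype.equivFin ι).symm
    refine ⟨Fintype.card ι, U.submatrix id fun k => (f k).1, ?_, ?_, ?_⟩
    · have hli : LinearIndependent ℝ (fun j => U.col j) := by
        have : IsUnit U := ⟨⟨U, Uᵀ, hU', hU⟩, rfl⟩
        exact linearIndependent_cols_of_isUnit this
      exact hli.comp (fun k => (f k).1) (Subtype.val_injective.comp f.injective)
    · exact fun k => ⟨w (f k).1, (f k).2, hcol _⟩
    · intro c v hc hv
      rw [hfix v]
      refine Submodule.sum_mem _ fun j _ => ?_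
      by_cases h : w j = c
      · refine Submodule.smul_mem _ _ (Submodule.subset_span ⟨f.symm ⟨j, h ▸ hc⟩, ?_⟩)
        ext i
        simp [Matrix.col]
      · simp [hsupp c v hv j h]

/-- Two symmetric matrices that fix each other's range coincide: P P' = P' and P' P = P, and a
transposition identifies them. Hence the algorithm does not depend on the chosen eigenvectors. -/
lemma isNegProj_of_eigenbasis {W : Matrix (Fin p) (Fin p) ℝ} (hW : Wᵀ = W) {r : ℕ}
    {Q : Matrix (Fin p) (Fin r) ℝ} (hQ : IsNegEigenbasis W Q) :
    IsNegProj W (Q * (Qᵀ * Q)⁻¹ * Qᵀ) := by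
  obtain ⟨P, hP, hfix, hspan, -⟩ := exists_negProj hW
  have hinj : Function.Injective Q.mulVec := mulVec_injective_iff.mpr hQ.indep
  have hdet : IsUnit (Qᵀ * Q).det := by
    rw [← isUnit_iff_isUnit_det]
    have := (PosDef.conjTranspose_mul_self Q hinj).isUnit
    simpa using this
  set P' := Q * (Qᵀ * Q)⁻¹ * Qᵀ with hP'
  have hs : P'ᵀ = P' := by
    rw [hP', transpose_mul, transpose_mul, transpose_transpose, transpose_nonsing_inv,
      transpose_mul, transpose_transpose, Matrix.mul_assoc]
  have h1 : P' * Q = Q := by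
    rw [hP', Matrix.mul_assoc, Matrix.mul_assoc, nonsing_inv_mul _ hdet, Matrix.mul_one]
  have h2 : P * Q = Q := by
    ext i j
    obtain ⟨c, hc, hv⟩ := hQ.eigen j
    exact congrFun (hfix c _ hc hv) i
  have h3 : P * P' = P' := by rw [hP', ← Matrix.mul_assoc, ← Matrix.mul_assoc, h2]
  have h4 : P' * P = P := by
    refine Matrix.toLin'.injective (LinearMap.ext fun v => ?_)
    rw [toLin'_apply, toLin'_apply, ← mulVec_mulVec]
    have hle : Submodule.span ℝ (Set.range fun j : Fin r => Q.col j)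
        ≤ LinearMap.eqLocus P'.mulVecLin LinearMap.id := by
      rw [Submodule.span_le]
      rintro _ ⟨j, rfl⟩
      ext i
      exact congrFun (congrFun h1 i) j
    exact hle (hspan Q hQ v)
  have h5 : P' = P := by
    rw [← hs, ← h3, transpose_mul, hs, hP.symm, h4]
  rwa [h5]

/-- The difference W T - W P equals W(1 - P) · T + (-W P) · (1 - T), and each summand is a product
of positive semidefinite matrices. -/
lemma IsNegProj.trace_le {W P T : Matrix (Fin p) (Fin p) ℝ} (h : IsNegProj W P)
    (hT : T.PosSemidef) (hT' : (1 - T).PosSemidef) : (W * P).trace ≤ (W * T).trace := by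
  have h1 := trace_mul_nonneg h.pos hT
  have h2 := trace_mul_nonneg h.neg hT'
  have h3 : W * (1 - P) * T + -(W * P) * (1 - T) = W * T - W * P := by noncomm_ring
  have h4 := congrArg trace h3
  rw [trace_add, trace_sub] at h4
  linarith

/-- Equality in the trace bound makes both nonnegative summands vanish, so W P (1 - T) = 0. Writing
P = Y W cancels W. -/
lemma IsNegProj.mul_eq_of_trace {W P T : Matrix (Fin p) (Fin p) ℝ} (h : IsNegProj W P)
    (hT : T.PosSemidef) (hT' : (1 - T).PosSemidef) (hle : (W * T).trace ≤ (W * P).trace) :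
    P * T = P := by
  have h1 := trace_mul_nonneg h.pos hT
  have h2 := trace_mul_nonneg h.neg hT'
  have h3 : W * (1 - P) * T + -(W * P) * (1 - T) = W * T - W * P := by noncomm_ring
  have h4 := congrArg trace h3
  rw [trace_add, trace_sub] at h4
  have h5 := mul_eq_zero_of_trace h.neg hT' (by linarith)
  obtain ⟨Y, hY⟩ := h.factor
  have h6 : P * (1 - T) = 0 := by
    calc P * (1 - T) = P * P * (1 - T) := by rw [h.idem]
      _ = Y * W * P * (1 - T) := by rw [← hY]
      _ = -Y * (-(W * P) * (1 - T)) := by noncomm_ring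
      _ = 0 := by rw [h5, Matrix.mul_zero]
  rw [Matrix.mul_sub, Matrix.mul_one, sub_eq_zero] at h6
  exact h6.symm

/-- Least rank singles out the projection among the minimizers. -/
lemma IsNegProj.eq_of_trace_of_rank {W P T : Matrix (Fin p) (Fin p) ℝ} (h : IsNegProj W P)
    (hT : T.PosSemidef) (hT' : (1 - T).PosSemidef) (hle : (W * T).trace ≤ (W * P).trace)
    (hr : T.rank ≤ P.rank) : T = P := by
  have h1 := h.mul_eq_of_trace hT hT' hle
  have h2 : T * P = P := by
    have := congrArg transpose h1
    rwa [transpose_mul, h.symm, PosSemidef.symm hT] at this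
  have h3 : LinearMap.range P.mulVecLin ≤ LinearMap.range T.mulVecLin := by
    rintro _ ⟨v, rfl⟩
    exact ⟨P *ᵥ v, by simp [mulVec_mulVec, h2]⟩
  have h4 := Submodule.eq_of_le_of_finrank_le h3 hr
  have h5 : P * T = T := by
    refine Matrix.toLin'.injective (LinearMap.ext fun v => ?_)
    rw [toLin'_apply, toLin'_apply, ← mulVec_mulVec]
    have : T *ᵥ v ∈ LinearMap.range P.mulVecLin := h4 ▸ ⟨v, rfl⟩
    obtain ⟨u, hu⟩ := this
    rw [← hu, mulVecLin_apply, mulVec_mulVec, h.idem]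
  rw [← h5, h1]

end MatrixLemmas

/-! ### Second moments of square integrable vectors. -/

section Moments

variable {Ω : Type*} {m0 : MeasurableSpace Ω} {μ : Measure Ω} {a b c d : ℕ}

/-- The matrix of mixed second moments `𝔼[f gᵀ]`. -/
noncomputable def momentMatrix (μ : Measure Ω) (f : Ω → E a) (g : Ω → E b) :
    Matrix (Fin a) (Fin b) ℝ :=
  Matrix.of fun i j => ∫ ω, f ω i * g ω j ∂μ

/-- The continuous linear map of a matrix between Euclidean spaces. -/
noncomputable def matCLM (A : Matrix (Fin b) (Fin a) ℝ) : E a →L[ℝ] E b :=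
  LinearMap.toContinuousLinearMap (Matrix.toEuclideanLin A)

@[simp] lemma matCLM_apply (A : Matrix (Fin b) (Fin a) ℝ) (x : E a) (i : Fin b) :
    matCLM A x i = ∑ j, A i j * x j := by
  simp [matCLM, mulVec, dotProduct]

lemma matCLM_mul (A : Matrix (Fin c) (Fin b) ℝ) (B : Matrix (Fin b) (Fin a) ℝ) (x : E a) :
    matCLM (A * B) x = matCLM A (matCLM B x) := by
  simp only [matCLM, LinearMap.coe_toContinuousLinearMap', toLpLin_apply, mulVec_mulVec]

lemma matCLM_add (A B : Matrix (Fin b) (Fin a) ℝ) (x : E a) :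
    matCLM (A + B) x = matCLM A x + matCLM B x := by
  simp [matCLM]

lemma matCLM_sub (A B : Matrix (Fin b) (Fin a) ℝ) (x : E a) :
    matCLM (A - B) x = matCLM A x - matCLM B x := by
  simp [matCLM]

lemma matCLM_one (x : E a) : matCLM 1 x = x := by
  simp [matCLM]

lemma momentMatrix_transpose (f : Ω → E a) (g : Ω → E b) :
    (momentMatrix μ f g)ᵀ = momentMatrix μ g f := by
  ext i j; simp [momentMatrix, mul_comm]

lemma integrable_coord_mul {f : Ω → E a} {g : Ω → E b} (hf : MemLp f 2 μ) (hg : MemLp g 2 μ)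
    (i : Fin a) (j : Fin b) : Integrable (fun ω => f ω i * g ω j) μ :=
  (hf.eval_piLp i).integrable_mul (hg.eval_piLp j)

lemma memLp_matCLM {f : Ω → E a} (hf : MemLp f 2 μ) (A : Matrix (Fin b) (Fin a) ℝ) :
    MemLp (fun ω => matCLM A (f ω)) 2 μ :=
  (matCLM A).comp_memLp' hf

lemma MemLp.fun_add {f g : Ω → E a} (hf : MemLp f 2 μ) (hg : MemLp g 2 μ) :
    MemLp (fun ω => f ω + g ω) 2 μ := hf.add hg

lemma MemLp.fun_sub {f g : Ω → E a} (hf : MemLp f 2 μ) (hg : MemLp g 2 μ) :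
    MemLp (fun ω => f ω - g ω) 2 μ := hf.sub hg

lemma momentMatrix_matCLM_left {f : Ω → E a} {g : Ω → E b} (hf : MemLp f 2 μ) (hg : MemLp g 2 μ)
    (A : Matrix (Fin c) (Fin a) ℝ) :
    momentMatrix μ (fun ω => matCLM A (f ω)) g = A * momentMatrix μ f g := by
  ext i j
  simp only [momentMatrix, of_apply, matCLM_apply, Matrix.mul_apply, Finset.sum_mul]
  rw [integral_finsetSum]
  · refine Finset.sum_congr rfl fun k _ => ?_
    rw [← integral_const_mul]
    simp only [mul_assoc]
  · intro k _
    simpa only [mul_assoc] using (integrable_coord_mul hf hg k j).const_mul (A i k)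

lemma momentMatrix_matCLM_right {f : Ω → E a} {g : Ω → E b} (hf : MemLp f 2 μ) (hg : MemLp g 2 μ)
    (A : Matrix (Fin c) (Fin b) ℝ) :
    momentMatrix μ f (fun ω => matCLM A (g ω)) = momentMatrix μ f g * Aᵀ := by
  rw [← momentMatrix_transpose, momentMatrix_matCLM_left hg hf, transpose_mul,
    momentMatrix_transpose]

lemma momentMatrix_add_left {f f' : Ω → E a} {g : Ω → E b} (hf : MemLp f 2 μ)
    (hf' : MemLp f' 2 μ) (hg : MemLp g 2 μ) :
    momentMatrix μ (fun ω => f ω + f' ω) g = momentMatrix μ f g + momentMatrix μ f' g := by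
  ext i j
  simp only [momentMatrix, of_apply, Matrix.add_apply, PiLp.add_apply, add_mul]
  exact integral_add (integrable_coord_mul hf hg i j) (integrable_coord_mul hf' hg i j)

lemma momentMatrix_add_right {f : Ω → E a} {g g' : Ω → E b} (hf : MemLp f 2 μ)
    (hg : MemLp g 2 μ) (hg' : MemLp g' 2 μ) :
    momentMatrix μ f (fun ω => g ω + g' ω) = momentMatrix μ f g + momentMatrix μ f g' := by
  rw [← momentMatrix_transpose, momentMatrix_add_left hg hg' hf, transpose_add,
    momentMatrix_transpose, momentMatrix_transpose]

lemma momentMatrix_sub_left {f f' : Ω → E a} {g : Ω → E b} (hf : MemLp f 2 μ)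
    (hf' : MemLp f' 2 μ) (hg : MemLp g 2 μ) :
    momentMatrix μ (fun ω => f ω - f' ω) g = momentMatrix μ f g - momentMatrix μ f' g := by
  ext i j
  simp only [momentMatrix, of_apply, Matrix.sub_apply, PiLp.sub_apply, sub_mul]
  exact integral_sub (integrable_coord_mul hf hg i j) (integrable_coord_mul hf' hg i j)

lemma momentMatrix_sub_right {f : Ω → E a} {g g' : Ω → E b} (hf : MemLp f 2 μ)
    (hg : MemLp g 2 μ) (hg' : MemLp g' 2 μ) :
    momentMatrix μ f (fun ω => g ω - g' ω) = momentMatrix μ f g - momentMatrix μ f g' := by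
  rw [← momentMatrix_transpose, momentMatrix_sub_left hg hg' hf, transpose_sub,
    momentMatrix_transpose, momentMatrix_transpose]

lemma momentMatrix_sub_self {f g : Ω → E a} (hf : MemLp f 2 μ) (hg : MemLp g 2 μ) :
    momentMatrix μ (fun ω => f ω - g ω) (fun ω => f ω - g ω) = momentMatrix μ f f
      - momentMatrix μ f g - (momentMatrix μ g f - momentMatrix μ g g) := by
  rw [momentMatrix_sub_left hf hg (MemLp.fun_sub hf hg), momentMatrix_sub_right hf hf hg,
    momentMatrix_sub_right hg hf hg]

lemma momentMatrix_congr {f f' : Ω → E a} {g g' : Ω → E b} (hf : f =ᵐ[μ] f')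
    (hg : g =ᵐ[μ] g') : momentMatrix μ f g = momentMatrix μ f' g' := by
  ext i j
  simp only [momentMatrix, of_apply]
  refine integral_congr_ae ?_
  filter_upwards [hf, hg] with ω h h'
  rw [h, h']

lemma integral_norm_sq_eq_trace {f : Ω → E a} (hf : MemLp f 2 μ) :
    ∫ ω, ‖f ω‖ ^ 2 ∂μ = (momentMatrix μ f f).trace := by
  simp only [EuclideanSpace.real_norm_sq_eq]
  simp only [pow_two, Matrix.trace, diag_apply, momentMatrix, of_apply]
  exact integral_finsetSum _ fun i _ => integrable_coord_mul hf hf i i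

lemma posSemidef_momentMatrix {f : Ω → E a} (hf : MemLp f 2 μ) :
    (momentMatrix μ f f).PosSemidef := by
  refine PosSemidef.of_dotProduct_mulVec_nonneg ?_ fun v => ?_
  · rw [IsHermitian, conjTranspose_eq_transpose_of_trivial, momentMatrix_transpose]
  -- The quadratic form at v is the second moment of the scalar v·f; v is encoded as a one-row
  -- matrix to reuse the linear rules.
  · have h := momentMatrix_matCLM_left hf hf (Matrix.of fun (_ : Fin 1) j => v j)
    have h' := momentMatrix_matCLM_right (memLp_matCLM hf (Matrix.of fun (_ : Fin 1) j => v j)) hf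
      (Matrix.of fun (_ : Fin 1) j => v j)
    rw [h] at h'
    have h0 := congrFun (congrFun h' 0) 0
    have h1 : star v ⬝ᵥ momentMatrix μ f f *ᵥ v = (Matrix.of (fun (_ : Fin 1) j => v j) *
        momentMatrix μ f f * (Matrix.of fun (_ : Fin 1) j => v j)ᵀ) 0 0 := by
      rw [Matrix.mul_assoc]; rfl
    rw [h1, ← h0]
    simp only [momentMatrix, of_apply]
    exact integral_nonneg fun ω => mul_self_nonneg _

lemma lintegral_enorm_sq {f : Ω → E a} (hf : MemLp f 2 μ) :
    ∫⁻ ω, ‖f ω‖ₑ ^ 2 ∂μ = ENNReal.ofReal (∫ ω, ‖f ω‖ ^ 2 ∂μ) := by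
  rw [ofReal_integral_eq_lintegral_ofReal ((memLp_two_iff_integrable_sq_norm hf.1).1 hf)
    (Filter.Eventually.of_forall fun _ => by positivity)]
  refine lintegral_congr fun ω => ?_
  rw [← ofReal_norm, ENNReal.ofReal_pow (norm_nonneg _)]

lemma memLp_of_lintegral_enorm_sq {f : Ω → E a} (hf : AEStronglyMeasurable f μ)
    (h : ∫⁻ ω, ‖f ω‖ₑ ^ 2 ∂μ < ∞) : MemLp f 2 μ := by
  refine ⟨hf, ?_⟩
  rw [eLpNorm_lt_top_iff_lintegral_rpow_enorm_lt_top (by norm_num) (by norm_num)]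
  simpa using h

/-- The defining orthogonality of the conditional expectation, for second moments. -/
lemma momentMatrix_condExp [IsProbabilityMeasure μ] {m : MeasurableSpace Ω} (hm : m ≤ m0)
    {f : Ω → E a} {g : Ω → E b} (hf : MemLp f 2 μ) (hg : MemLp g 2 μ)
    (hgm : AEStronglyMeasurable[m] g μ) :
    momentMatrix μ g (μ[f | m]) = momentMatrix μ g f := by
  ext i j
  simp only [momentMatrix, of_apply]
  have h1 : (fun ω => (μ[f | m]) ω j) =ᵐ[μ] μ[fun ω => f ω j | m] :=
    ContinuousLinearMap.comp_condExp_comm (hf.integrable (by norm_num))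
      (EuclideanSpace.proj (𝕜 := ℝ) j)
  have h2 : AEStronglyMeasurable[m] (fun ω => g ω i) μ :=
    (EuclideanSpace.proj (𝕜 := ℝ) i).continuous.comp_aestronglyMeasurable hgm
  have h3 := condExp_mul_of_aestronglyMeasurable_left h2 (integrable_coord_mul hg hf i j)
    ((hf.eval_piLp j).integrable (by norm_num))
  calc ∫ ω, g ω i * (μ[f | m]) ω j ∂μ
      = ∫ ω, (μ[(fun ω => g ω i) * (fun ω => f ω j) | m]) ω ∂μ := by
        refine integral_congr_ae ?_
        filter_upwards [h1, h3] with ω e1 e3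
        rw [e3, e1, Pi.mul_apply]
    _ = ∫ ω, g ω i * f ω j ∂μ := by rw [integral_condExp hm]; rfl

end Moments

/-! ### Posterior covariances and the receiver's best response. -/

section Posterior

variable {p q t : ℕ} {Sx : Matrix (Fin p) (Fin p) ℝ} {Y : Type*} [mY : MeasurableSpace Y]

instance : IsGaussian (stateLaw Sx) := by unfold stateLaw; infer_instance

lemma memLp_state : MemLp (fun x : E p => x) 2 (stateLaw Sx) :=
  IsGaussian.memLp_two_id

lemma momentMatrix_state (hSx : Sx.PosSemidef) :
    momentMatrix (stateLaw Sx) (fun x : E p => x) (fun x => x) = Sx := by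
  ext i j
  have h := covariance_eval_multivariateGaussian (μ := 0) hSx i j
  have h0 : ∀ k : Fin p, ∫ x : E p, x k ∂(stateLaw Sx) = 0 := by
    intro k
    have := ContinuousLinearMap.integral_comp_comm (EuclideanSpace.proj (𝕜 := ℝ) k)
      ((memLp_state (Sx := Sx)).integrable (by norm_num))
    rw [stateLaw, integral_id_multivariateGaussian] at this
    simpa [stateLaw] using this
  have h1 := covariance_eq_sub ((memLp_state (Sx := Sx)).eval_piLp i)
    ((memLp_state (Sx := Sx)).eval_piLp j)
  rw [h0 i, zero_mul, sub_zero] at h1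
  simp only [momentMatrix, of_apply]
  rw [← h]
  exact h1.symm

lemma memLp_posteriorMean (y : E p → Y) : MemLp (posteriorMean Sx y) 2 (stateLaw Sx) :=
  memLp_state.condExp (by norm_num)

lemma stronglyMeasurable_posteriorMean (y : E p → Y) :
    StronglyMeasurable[mY.comap y] (posteriorMean Sx y) :=
  stronglyMeasurable_condExp

lemma posteriorCov_eq (y : E p → Y) : posteriorCov Sx y =
    momentMatrix (stateLaw Sx) (posteriorMean Sx y) (posteriorMean Sx y) := rfl

lemma momentMatrix_posteriorMean {b : ℕ} {y : E p → Y} (hy : Measurable y) {g : E p → E b}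
    (hg : MemLp g 2 (stateLaw Sx)) (hgm : AEStronglyMeasurable[mY.comap y] g (stateLaw Sx)) :
    momentMatrix (stateLaw Sx) g (posteriorMean Sx y)
      = momentMatrix (stateLaw Sx) g (fun x => x) :=
  momentMatrix_condExp hy.comap_le memLp_state hg hgm

lemma momentMatrix_posteriorMean_state {y : E p → Y} (hy : Measurable y) :
    momentMatrix (stateLaw Sx) (posteriorMean Sx y) (fun x => x) = posteriorCov Sx y := by
  rw [posteriorCov_eq, momentMatrix_posteriorMean hy (memLp_posteriorMean y)
    (stronglyMeasurable_posteriorMean y).aestronglyMeasurable]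

lemma posteriorCov_transpose (y : E p → Y) : (posteriorCov Sx y)ᵀ = posteriorCov Sx y := by
  rw [posteriorCov_eq, momentMatrix_transpose]

lemma momentMatrix_state_posteriorMean {y : E p → Y} (hy : Measurable y) :
    momentMatrix (stateLaw Sx) (fun x => x) (posteriorMean Sx y) = posteriorCov Sx y := by
  rw [← momentMatrix_transpose, momentMatrix_posteriorMean_state hy, posteriorCov_transpose]

lemma posteriorCov_posSemidef (y : E p → Y) : (posteriorCov Sx y).PosSemidef :=
  posSemidef_momentMatrix (memLp_posteriorMean y)

/-- The difference is the second moment of the error x - x̂, as all cross moments equal the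
posterior covariance. -/
lemma posteriorCov_le (hSx : Sx.PosSemidef) {y : E p → Y} (hy : Measurable y) :
    (Sx - posteriorCov Sx y).PosSemidef := by
  have hx := memLp_state (Sx := Sx)
  have hh := memLp_posteriorMean (Sx := Sx) y
  have h := posSemidef_momentMatrix (MemLp.fun_sub hx hh)
  rwa [momentMatrix_sub_self hx hh, momentMatrix_state hSx, momentMatrix_posteriorMean_state hy,
    momentMatrix_state_posteriorMean hy, ← posteriorCov_eq, sub_self, sub_zero] at h

/-- A finer signal has a larger posterior covariance. -/
lemma posteriorCov_mono {Z : Type*} [mZ : MeasurableSpace Z] {y : E p → Y} {z : E p → Z}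
    (hy : Measurable y) (hz : Measurable z) (hyz : mY.comap y ≤ mZ.comap z) :
    (posteriorCov Sx z - posteriorCov Sx y).PosSemidef := by
  have h1 := memLp_posteriorMean (Sx := Sx) y
  have h2 := memLp_posteriorMean (Sx := Sx) z
  have h := posSemidef_momentMatrix (MemLp.fun_sub h2 h1)
  -- The coarser estimate is measurable for the finer signal, so its moment with the finer estimate
  -- equals its moment with x. The difference of covariances is then a second moment.
  have e12 : momentMatrix (stateLaw Sx) (posteriorMean Sx y) (posteriorMean Sx z)
      = posteriorCov Sx y := by
    rw [momentMatrix_posteriorMean hz h1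
      ((stronglyMeasurable_posteriorMean y).mono hyz).aestronglyMeasurable,
      momentMatrix_posteriorMean_state hy]
  have e21 : momentMatrix (stateLaw Sx) (posteriorMean Sx z) (posteriorMean Sx y)
      = posteriorCov Sx y := by
    rw [← momentMatrix_transpose, e12, posteriorCov_transpose]
  rwa [momentMatrix_sub_self h2 h1, e12, e21, ← posteriorCov_eq, ← posteriorCov_eq, sub_self,
    sub_zero] at h

/-! ### The receiver's best response -/

variable {Qr : Matrix (Fin q) (Fin p) ℝ} {Rr : Matrix (Fin q) (Fin t) ℝ}

/-- The gain of the receiver: its best response is `-K x̂`. -/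
noncomputable def gain (Qr : Matrix (Fin q) (Fin p) ℝ) (Rr : Matrix (Fin q) (Fin t) ℝ) :
    Matrix (Fin t) (Fin p) ℝ := (Rrᵀ * Rr)⁻¹ * Rrᵀ * Qr

/-- The normal equations of least squares; they remove the cross term in `integral_cost_decomp`. -/
lemma gain_normal_eq (hRr : IsUnit (Rrᵀ * Rr)) : (Qr - Rr * gain Qr Rr)ᵀ * Rr = 0 := by
  have h : IsUnit (Rrᵀ * Rr).det := (isUnit_iff_isUnit_det _).1 hRr
  have h1 : Rrᵀ * (Rr * gain Qr Rr) = Rrᵀ * Qr := by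
    rw [gain, ← Matrix.mul_assoc, ← Matrix.mul_assoc, ← Matrix.mul_assoc, mul_nonsing_inv _ h,
      Matrix.one_mul]
  have h2 : Rrᵀ * (Qr - Rr * gain Qr Rr) = 0 := by rw [Matrix.mul_sub, h1, sub_self]
  simpa using congrArg transpose h2

lemma matCLM_injective (hRr : IsUnit (Rrᵀ * Rr)) (u : E t) :
    matCLM ((Rrᵀ * Rr)⁻¹ * Rrᵀ) (matCLM Rr u) = u := by
  rw [← matCLM_mul, Matrix.mul_assoc, nonsing_inv_mul _ ((isUnit_iff_isUnit_det _).1 hRr),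
    matCLM_one]

/-- Pythagoras: the deviation d = K x̂ + g is a function of the signal, so 𝔼[d x̂ᵀ] = 𝔼[d xᵀ], and
the normal equations make Rr d orthogonal to the residual. Only the last term depends on the action.
-/
lemma integral_cost_decomp (hRr : IsUnit (Rrᵀ * Rr)) {y : E p → Y} (hy : Measurable y)
    {g : E p → E t} (hg : MemLp g 2 (stateLaw Sx))
    (hgm : AEStronglyMeasurable[mY.comap y] g (stateLaw Sx)) :
    ∫ x, ‖matCLM Qr x + matCLM Rr (g x)‖ ^ 2 ∂(stateLaw Sx) =
      ∫ x, ‖matCLM Qr x - matCLM (Rr * gain Qr Rr) (posteriorMean Sx y x)‖ ^ 2 ∂(stateLaw Sx) +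
      ∫ x, ‖matCLM Rr (matCLM (gain Qr Rr) (posteriorMean Sx y x) + g x)‖ ^ 2 ∂(stateLaw Sx) := by
  set K := gain Qr Rr with hK
  have hx := memLp_state (Sx := Sx)
  have hh := memLp_posteriorMean (Sx := Sx) y
  have hd := (memLp_matCLM hh K).add hg
  have hdm : AEStronglyMeasurable[mY.comap y]
      ((fun x => matCLM K (posteriorMean Sx y x)) + g) (stateLaw Sx) :=
    ((matCLM K).continuous.comp_aestronglyMeasurable
      (stronglyMeasurable_posteriorMean y).aestronglyMeasurable).add hgm
  set d : E p → E t := (fun x => matCLM K (posteriorMean Sx y x)) + g with hdef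
  have hr := (memLp_matCLM hx Qr).sub (memLp_matCLM hh (Rr * K))
  set r : E p → E q := (fun x => matCLM Qr x) - fun x => matCLM (Rr * K) (posteriorMean Sx y x)
    with hrdef
  have hRd := memLp_matCLM hd Rr
  have e1 : (fun x => matCLM Qr x + matCLM Rr (g x)) = fun x => r x + matCLM Rr (d x) := by
    ext1 x
    simp only [hrdef, hdef, Pi.sub_apply, Pi.add_apply, map_add, matCLM_mul]
    abel
  have e2 : momentMatrix (stateLaw Sx) d r
      = momentMatrix (stateLaw Sx) d (fun x => x) * (Qr - Rr * K)ᵀ := by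
    rw [show r = fun x => matCLM Qr x - matCLM (Rr * K) (posteriorMean Sx y x) from rfl,
      momentMatrix_sub_right hd (memLp_matCLM hx Qr) (memLp_matCLM hh (Rr * K)),
      momentMatrix_matCLM_right hd hx, momentMatrix_matCLM_right hd hh,
      momentMatrix_posteriorMean hy hd hdm, transpose_sub, Matrix.mul_sub]
  have e3 : (momentMatrix (stateLaw Sx) (fun x => matCLM Rr (d x)) r).trace = 0 := by
    rw [momentMatrix_matCLM_left hd hr, e2, trace_mul_comm, Matrix.mul_assoc, hK,
      gain_normal_eq hRr]
    simp
  have e4 : (momentMatrix (stateLaw Sx) r (fun x => matCLM Rr (d x))).trace = 0 := by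
    rw [← e3, ← momentMatrix_transpose, trace_transpose]
  have e5 : ∫ x, ‖r x + matCLM Rr (d x)‖ ^ 2 ∂(stateLaw Sx)
      = ∫ x, ‖r x‖ ^ 2 ∂(stateLaw Sx) + ∫ x, ‖matCLM Rr (d x)‖ ^ 2 ∂(stateLaw Sx) := by
    rw [integral_norm_sq_eq_trace hr, integral_norm_sq_eq_trace hRd,
      integral_norm_sq_eq_trace (MemLp.fun_add hr hRd),
      momentMatrix_add_left hr hRd (MemLp.fun_add hr hRd),
      momentMatrix_add_right hr hr hRd, momentMatrix_add_right hRd hr hRd]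
    simp only [trace_add, e3, e4]
    ring
  simp_rw [funext_iff.1 e1]
  exact e5

/-- A left inverse of Rr recovers the action from a square integrable quantity. Policies of infinite
cost need no comparison. -/
lemma memLp_of_cost {y : E p → Y} (hy : Measurable y) (hRr : IsUnit (Rrᵀ * Rr)) {γ : Y → E t}
    (hγ : Measurable γ) (hc : expectedCost Sx Qr Rr y γ < ∞) :
    MemLp (fun x => γ (y x)) 2 (stateLaw Sx) := by
  have hm : Measurable fun x => γ (y x) := hγ.comp hy
  have h1 : MemLp (fun x => matCLM Qr x + matCLM Rr (γ (y x))) 2 (stateLaw Sx) :=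
    memLp_of_lintegral_enorm_sq (Measurable.aestronglyMeasurable (by fun_prop)) hc
  have h2 : MemLp (fun x => matCLM Rr (γ (y x))) 2 (stateLaw Sx) := by
    have := h1.sub (memLp_matCLM memLp_state Qr)
    refine this.ae_eq (Filter.Eventually.of_forall fun x => ?_)
    simp
  have h3 := memLp_matCLM h2 ((Rrᵀ * Rr)⁻¹ * Rrᵀ)
  simpa only [matCLM_injective hRr] using h3

lemma expectedCost_eq {Z : Type*} {Q : Matrix (Fin q) (Fin p) ℝ} {R : Matrix (Fin q) (Fin t) ℝ}
    {y : E p → Z} {γ : Z → E t} (hg : MemLp (fun x => γ (y x)) 2 (stateLaw Sx)) :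
    expectedCost Sx Q R y γ =
      ENNReal.ofReal (∫ x, ‖matCLM Q x + matCLM R (γ (y x))‖ ^ 2 ∂(stateLaw Sx)) :=
  lintegral_enorm_sq ((memLp_matCLM memLp_state Q).add (memLp_matCLM hg R))

lemma aestronglyMeasurable_comp {y : E p → Y} {γ : Y → E t} (hγ : Measurable γ) :
    AEStronglyMeasurable[mY.comap y] (fun x => γ (y x)) (stateLaw Sx) :=
  (hγ.comp (comap_measurable y)).stronglyMeasurable.aestronglyMeasurable

lemma memLp_of_ae_eq_gain {y : E p → Y} {γ : Y → E t}
    (h : (fun x => γ (y x)) =ᵐ[stateLaw Sx]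
      fun x => -matCLM (gain Qr Rr) (posteriorMean Sx y x)) :
    MemLp (fun x => γ (y x)) 2 (stateLaw Sx) :=
  (memLp_matCLM (memLp_posteriorMean y) (gain Qr Rr)).neg.ae_eq h.symm

lemma isBestResponse_of_ae_eq (hRr : IsUnit (Rrᵀ * Rr)) {y : E p → Y} (hy : Measurable y)
    {γ : Y → E t} (hγ : Measurable γ)
    (h : (fun x => γ (y x)) =ᵐ[stateLaw Sx]
      fun x => -matCLM (gain Qr Rr) (posteriorMean Sx y x)) :
    IsBestResponse Sx Qr Rr y γ := by
  refine ⟨hγ, fun γ' hγ' => ?_⟩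
  by_cases hc : expectedCost Sx Qr Rr y γ' < ∞
  · have hg := memLp_of_ae_eq_gain h
    have hg' := memLp_of_cost hy hRr hγ' hc
    rw [expectedCost_eq hg, expectedCost_eq hg',
      integral_cost_decomp hRr hy hg (aestronglyMeasurable_comp hγ),
      integral_cost_decomp hRr hy hg' (aestronglyMeasurable_comp hγ')]
    refine ENNReal.ofReal_le_ofReal (add_le_add le_rfl ?_)
    have h0 : ∫ x, ‖matCLM Rr (matCLM (gain Qr Rr) (posteriorMean Sx y x) + γ (y x))‖ ^ 2
        ∂(stateLaw Sx) = 0 := by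
      rw [integral_eq_zero_of_ae]
      filter_upwards [h] with x hx
      simp [hx]
    rw [h0]
    exact integral_nonneg fun x => by positivity
  · rw [not_lt_top_iff.1 hc]; exact le_top

/-- Doob–Dynkin factorization: the estimate is measurable for the σ-algebra of the signal, hence a
measurable function of it. -/
lemma exists_measurable_gain (y : E p → Y) : ∃ γ : Y → E t, Measurable γ ∧
    ∀ x, γ (y x) = -matCLM (gain Qr Rr) (posteriorMean Sx y x) := by
  have h : StronglyMeasurable[mY.comap y]
      fun x => -matCLM (gain Qr Rr) (posteriorMean Sx y x) :=
    ((matCLM (gain Qr Rr)).continuous.comp_stronglyMeasurable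
      (stronglyMeasurable_posteriorMean y)).neg
  obtain ⟨γ, hγ, e⟩ := h.exists_eq_measurable_comp
  exact ⟨γ, hγ.measurable, fun x => (congrFun e x).symm⟩

/-- Comparison with the explicit optimum makes the integrated squared deviation zero, and Rr is
injective. Thus results hold for every reaction, not for a selected one. -/
lemma IsBestResponse.ae_eq (hRr : IsUnit (Rrᵀ * Rr)) {y : E p → Y} (hy : Measurable y)
    {γ : Y → E t} (hγ : IsBestResponse Sx Qr Rr y γ) :
    (fun x => γ (y x)) =ᵐ[stateLaw Sx]
      fun x => -matCLM (gain Qr Rr) (posteriorMean Sx y x) := by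
  obtain ⟨γ₀, h0m, h0⟩ := exists_measurable_gain (Sx := Sx) (Qr := Qr) (Rr := Rr) y
  have hg0 := memLp_of_ae_eq_gain (Qr := Qr) (Rr := Rr)
    (Filter.Eventually.of_forall (f := ae (stateLaw Sx)) h0)
  have hle := hγ.optimal γ₀ h0m
  have hg := memLp_of_cost hy hRr hγ.measurable
    (hle.trans_lt (by rw [expectedCost_eq hg0]; exact ENNReal.ofReal_lt_top))
  rw [expectedCost_eq hg, expectedCost_eq hg0, ENNReal.ofReal_le_ofReal_iff
    (integral_nonneg fun x => by positivity),
    integral_cost_decomp hRr hy hg (aestronglyMeasurable_comp hγ.measurable),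
    integral_cost_decomp hRr hy hg0 (aestronglyMeasurable_comp h0m)] at hle
  simp only [h0, add_neg_cancel, map_zero, norm_zero, ne_eq, OfNat.ofNat_ne_zero,
    not_false_eq_true, zero_pow, integral_zero, add_le_iff_nonpos_right, add_zero] at hle
  have hd := memLp_matCLM
    (MemLp.fun_add (memLp_matCLM (memLp_posteriorMean (Sx := Sx) y) (gain Qr Rr)) hg) Rr
  have hz := le_antisymm hle (integral_nonneg fun x => by positivity)
  rw [integral_eq_zero_iff_of_nonneg (fun x => by positivity)
    ((memLp_two_iff_integrable_sq_norm hd.1).1 hd)] at hz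
  filter_upwards [hz] with x hx
  have h1 : matCLM Rr (matCLM (gain Qr Rr) (posteriorMean Sx y x) + γ (y x)) = 0 := by
    simpa using hx
  have h2 := matCLM_injective hRr (matCLM (gain Qr Rr) (posteriorMean Sx y x) + γ (y x))
  rw [h1, map_zero] at h2
  exact eq_neg_of_add_eq_zero_right h2.symm

/-- Against a best response, the cost of a sender is affine in the posterior covariance. -/
lemma IsBestResponse.expectedCost_eq (hSx : Sx.PosSemidef) (hRr : IsUnit (Rrᵀ * Rr))
    {y : E p → Y} (hy : Measurable y) {γ : Y → E t} (hγ : IsBestResponse Sx Qr Rr y γ)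
    (Q : Matrix (Fin q) (Fin p) ℝ) (R : Matrix (Fin q) (Fin t) ℝ) :
    0 ≤ (Qᵀ * Q * Sx).trace + (costMatrix Q R Qr Rr * posteriorCov Sx y).trace ∧
    expectedCost Sx Q R y γ = ENNReal.ofReal
      ((Qᵀ * Q * Sx).trace + (costMatrix Q R Qr Rr * posteriorCov Sx y).trace) := by
  have hae := hγ.ae_eq hRr hy
  have hx := memLp_state (Sx := Sx)
  have hh := memLp_posteriorMean (Sx := Sx) y
  set L := R * gain Qr Rr with hL
  have hL' : R * (Rrᵀ * Rr)⁻¹ * Rrᵀ * Qr = L := by rw [hL, gain]; simp only [Matrix.mul_assoc]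
  have hQx := memLp_matCLM hx Q
  have hLh := memLp_matCLM hh L
  have e : ∫ x, ‖matCLM Q x + matCLM R (γ (y x))‖ ^ 2 ∂(stateLaw Sx) =
      (Qᵀ * Q * Sx).trace + (costMatrix Q R Qr Rr * posteriorCov Sx y).trace := by
    have e1 : ∫ x, ‖matCLM Q x + matCLM R (γ (y x))‖ ^ 2 ∂(stateLaw Sx)
        = ∫ x, ‖matCLM Q x - matCLM L (posteriorMean Sx y x)‖ ^ 2 ∂(stateLaw Sx) := by
      refine integral_congr_ae ?_
      filter_upwards [hae] with x hx
      simp only [hx, map_neg, hL, matCLM_mul, sub_eq_add_neg]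
    rw [e1, integral_norm_sq_eq_trace (MemLp.fun_sub hQx hLh), momentMatrix_sub_self hQx hLh,
      momentMatrix_matCLM_left hx hQx, momentMatrix_matCLM_left hx hLh,
      momentMatrix_matCLM_left hh hQx, momentMatrix_matCLM_left hh hLh,
      momentMatrix_matCLM_right hx hx, momentMatrix_matCLM_right hx hh,
      momentMatrix_matCLM_right hh hx, momentMatrix_matCLM_right hh hh, momentMatrix_state hSx,
      momentMatrix_posteriorMean_state hy, momentMatrix_state_posteriorMean hy, ← posteriorCov_eq,
      costMatrix]
    simp only [hL', trace_sub, Matrix.sub_mul, ← Matrix.mul_assoc]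
    rw [trace_mul_comm _ Qᵀ, trace_mul_comm _ Lᵀ, trace_mul_comm _ Qᵀ, trace_mul_comm _ Lᵀ]
    simp only [← Matrix.mul_assoc]
    ring
  refine ⟨?_, ?_⟩
  · rw [← e]; exact integral_nonneg fun x => by positivity
  · rw [SenderGame.expectedCost_eq (memLp_of_ae_eq_gain hae), e]

lemma exists_reaction (hRr : IsUnit (Rrᵀ * Rr)) (obs : (E p → E p) → E p → Y)
    (hobs : ∀ η, Measurable η → Measurable (obs η)) :
    ∃ γ : (E p → E p) → Y → E t, IsReceiverReaction Sx Qr Rr obs γ := by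
  choose γ hγ h using fun η => exists_measurable_gain (Sx := Sx) (Qr := Qr) (Rr := Rr) (obs η)
  exact ⟨γ, fun η hη => isBestResponse_of_ae_eq hRr (hobs η hη) (hγ η)
    (Filter.Eventually.of_forall (h η))⟩

/-- A policy is an equilibrium exactly when its posterior covariance minimizes the trace
objective among the policies of the sender. -/
lemma isStackelberg_iff (hSx : Sx.PosSemidef) (hRr : IsUnit (Rrᵀ * Rr))
    {Q : Matrix (Fin q) (Fin p) ℝ} {R : Matrix (Fin q) (Fin t) ℝ} {obs : (E p → E p) → E p → Y}
    (hobs : ∀ η, Measurable η → Measurable (obs η)) {η : E p → E p}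
    {γ : (E p → E p) → Y → E t} :
    IsStackelberg Sx Q R Qr Rr obs η γ ↔ Measurable η ∧ IsReceiverReaction Sx Qr Rr obs γ ∧
      ∀ η', Measurable η' → (costMatrix Q R Qr Rr * posteriorCov Sx (obs η)).trace
        ≤ (costMatrix Q R Qr Rr * posteriorCov Sx (obs η')).trace := by
  have key : ∀ {η η'}, Measurable η → Measurable η' → IsReceiverReaction Sx Qr Rr obs γ →
      (expectedCost Sx Q R (obs η) (γ η) ≤ expectedCost Sx Q R (obs η') (γ η') ↔
        (costMatrix Q R Qr Rr * posteriorCov Sx (obs η)).trace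
        ≤ (costMatrix Q R Qr Rr * posteriorCov Sx (obs η')).trace) := by
    intro η η' h h' hr
    have a := (hr η h).expectedCost_eq hSx hRr (hobs η h) Q R
    have b := (hr η' h').expectedCost_eq hSx hRr (hobs η' h') Q R
    -- Nonnegativity of the right-hand cost keeps `ENNReal.ofReal` from truncating the comparison.
    rw [a.2, b.2, ENNReal.ofReal_le_ofReal_iff b.1, add_le_add_iff_left]
  constructor
  · exact fun h => ⟨h.measurable, h.reaction, fun η' h' =>
      (key h.measurable h' h.reaction).1 (h.optimal η' h')⟩
  · exact fun ⟨h1, h2, h3⟩ => ⟨h1, h2, fun η' h' => (key h1 h' h2).2 (h3 η' h')⟩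

end Posterior

/-! ### Posterior covariances of linear signals of the Gaussian state. -/

section LinearPosterior

variable {p a b : ℕ} {Sx : Matrix (Fin p) (Fin p) ℝ}

lemma inner_matCLM (N : Matrix (Fin b) (Fin a) ℝ) (v : E b) (x : E a) :
    inner ℝ v (matCLM N x) = inner ℝ (matCLM Nᵀ v) x := by
  simp only [PiLp.inner_apply, matCLM_apply, RCLike.inner_apply, conj_trivial, transpose_apply,
    Finset.sum_mul, Finset.mul_sum]
  rw [Finset.sum_comm]
  exact Finset.sum_congr rfl fun i _ => Finset.sum_congr rfl fun j _ => by ring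

lemma covariance_matCLM_eq_zero (hSx : Sx.PosSemidef) {N : Matrix (Fin b) (Fin p) ℝ}
    {A : Matrix (Fin a) (Fin p) ℝ} (h : N * Sx * Aᵀ = 0) (v : E b) (ℓ : StrongDual ℝ (E a)) :
    cov[fun x => inner ℝ v (matCLM N x), fun x => ℓ (matCLM A x); stateLaw Sx] = 0 := by
  set w := (InnerProductSpace.toDual ℝ (E a)).symm ℓ with hw
  have hℓ : ∀ x, ℓ (matCLM A x) = inner ℝ (matCLM Aᵀ w) x := fun x => by
    rw [← inner_matCLM, hw, InnerProductSpace.toDual_symm_apply]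
  simp_rw [hℓ, inner_matCLM]
  rw [← covarianceBilin_apply_eq_cov IsGaussian.memLp_two_id, stateLaw,
    covarianceBilin_multivariateGaussian hSx]
  have e1 : (matCLM Aᵀ w).ofLp = Aᵀ *ᵥ w.ofLp := rfl
  have e2 : (matCLM Nᵀ v).ofLp = Nᵀ *ᵥ v.ofLp := rfl
  rw [e1, e2, mulVec_transpose, ← dotProduct_mulVec, mulVec_mulVec, mulVec_mulVec, h]
  simp

variable {F : Type*} [NormedAddCommGroup F] [NormedSpace ℝ F] [mF : MeasurableSpace F]
  [BorelSpace F] [SecondCountableTopology F] [CompleteSpace F]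

/-- If `T x` is a function of the linear observation `L x` and `x - T x` is uncorrelated with it,
then `T x` is the posterior mean. -/
lemma posteriorMean_linear (L : E p →L[ℝ] F) (T : Matrix (Fin p) (Fin p) ℝ)
    {φ : F → E p} (hφ : Measurable φ) (hT : ∀ x, matCLM T x = φ (L x))
    (hcov : ∀ (v : E p) (ℓ : StrongDual ℝ F),
      cov[fun x => inner ℝ v (matCLM (1 - T) x), fun x => ℓ (L x); stateLaw Sx] = 0) :
    posteriorMean Sx L =ᵐ[stateLaw Sx] fun x => matCLM T x := by
  have hL : Measurable L := L.continuous.measurable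
  -- Jointly Gaussian and uncorrelated implies independent, so conditioning the error x - T x on the
  -- signal returns its mean, which is 0.
  have hg : HasGaussianLaw (fun x : E p => (matCLM (1 - T) x, L x)) (stateLaw Sx) :=
    (IsGaussian.hasGaussianLaw_id (μ := stateLaw Sx)).map_fun ((matCLM (1 - T)).prod L)
  have hind : IndepFun (fun x : E p => matCLM (1 - T) x) (fun x => L x) (stateLaw Sx) := by
    refine hg.indepFun_of_covariance_strongDual fun ℓ₁ ℓ₂ => ?_
    have := hcov ((InnerProductSpace.toDual ℝ (E p)).symm ℓ₁) ℓ₂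
    simp only [InnerProductSpace.toDual_symm_apply] at this
    exact this
  have hN : Measurable fun x : E p => matCLM (1 - T) x := (matCLM (1 - T)).continuous.measurable
  have h1 := condExp_indep_eq (μ := stateLaw Sx) (f := fun x : E p => matCLM (1 - T) x)
    hN.comap_le hL.comap_le (comap_measurable _).stronglyMeasurable hind
  have hx := (memLp_state (Sx := Sx)).integrable (by norm_num)
  have h2 : ∫ x, matCLM (1 - T) x ∂(stateLaw Sx) = 0 := by
    rw [ContinuousLinearMap.integral_comp_comm _ hx, stateLaw, integral_id_multivariateGaussian,
      map_zero]
  have hTm : StronglyMeasurable[mF.comap L] fun x : E p => matCLM T x := by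
    simp_rw [hT]
    exact (hφ.comp (comap_measurable L)).stronglyMeasurable
  have hTi : Integrable (fun x : E p => matCLM T x) (stateLaw Sx) :=
    (memLp_matCLM memLp_state T).integrable (by norm_num)
  have hNi : Integrable (fun x : E p => matCLM (1 - T) x) (stateLaw Sx) :=
    (memLp_matCLM memLp_state (1 - T)).integrable (by norm_num)
  have h3 := condExp_of_stronglyMeasurable (μ := stateLaw Sx) hL.comap_le hTm hTi
  have h4 := condExp_add hNi hTi (mF.comap L)
  have h5 : (fun x : E p => matCLM (1 - T) x) + (fun x => matCLM T x) = fun x => x := by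
    ext1 x
    simp [matCLM_sub, matCLM_one]
  rw [h5] at h4
  unfold posteriorMean
  filter_upwards [h1, h4] with x e1 e4
  rw [e4, Pi.add_apply, e1, h2, h3, zero_add]

/-- Testing with dual functionals instead of inner products lets one statement cover a single signal
and a pair, whose product norm is not Euclidean. -/
lemma posteriorCov_linear (hSx : Sx.PosSemidef) (L : E p →L[ℝ] F)
    (T : Matrix (Fin p) (Fin p) ℝ) {φ : F → E p} (hφ : Measurable φ)
    (hT : ∀ x, matCLM T x = φ (L x))
    (hcov : ∀ (v : E p) (ℓ : StrongDual ℝ F),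
      cov[fun x => inner ℝ v (matCLM (1 - T) x), fun x => ℓ (L x); stateLaw Sx] = 0) :
    posteriorCov Sx L = T * Sx := by
  rw [← momentMatrix_posteriorMean_state L.continuous.measurable,
    momentMatrix_congr (posteriorMean_linear L T hφ hT hcov) (Filter.EventuallyEq.refl _ _),
    momentMatrix_matCLM_left memLp_state memLp_state, momentMatrix_state hSx]

lemma measurable_linearPolicy (A : Matrix (Fin p) (Fin p) ℝ) : Measurable (linearPolicy A) :=
  (matCLM A).continuous.measurable

lemma posteriorCov_linearPolicy (hSx : Sx.PosSemidef) {A G : Matrix (Fin p) (Fin p) ℝ}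
    (h : (1 - G * A) * Sx * Aᵀ = 0) : posteriorCov Sx (linearPolicy A) = G * A * Sx :=
  posteriorCov_linear hSx (matCLM A) (G * A) (matCLM G).continuous.measurable
    (fun x => matCLM_mul G A x) fun v ℓ => covariance_matCLM_eq_zero hSx h v ℓ

lemma posteriorCov_obsAfter (hSx : Sx.PosSemidef) {A B G K : Matrix (Fin p) (Fin p) ℝ}
    (hA : (1 - (G * A + K * B)) * Sx * Aᵀ = 0) (hB : (1 - (G * A + K * B)) * Sx * Bᵀ = 0) :
    posteriorCov Sx (obsAfter (linearPolicy A) (linearPolicy B)) = (G * A + K * B) * Sx := by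
  refine posteriorCov_linear hSx ((matCLM A).prod (matCLM B)) (G * A + K * B)
    (φ := fun y => matCLM G y.1 + matCLM K y.2) (by fun_prop)
    (fun x => by simp [matCLM_add, matCLM_mul]) fun v ℓ => ?_
  -- A functional on pairs is the sum of its restrictions to the two factors, so the two
  -- orthogonality hypotheses suffice.
  have e : (fun x : E p => ℓ ((matCLM A).prod (matCLM B) x)) =
      (fun x => (ℓ.comp (ContinuousLinearMap.inl ℝ (E p) (E p))) (matCLM A x)) +
      fun x => (ℓ.comp (ContinuousLinearMap.inr ℝ (E p) (E p))) (matCLM B x) := by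
    ext1 x
    simp [← map_add]
  have m : ∀ (f : E p →L[ℝ] ℝ), MemLp (fun x => f x) 2 (stateLaw Sx) := fun f =>
    f.comp_memLp' memLp_state
  have hadd := covariance_add_right (m ((innerSL ℝ v).comp (matCLM (1 - (G * A + K * B)))))
    (m ((ℓ.comp (ContinuousLinearMap.inl ℝ (E p) (E p))).comp (matCLM A)))
    (m ((ℓ.comp (ContinuousLinearMap.inr ℝ (E p) (E p))).comp (matCLM B)))
  rw [e]
  refine hadd.trans ?_
  have zA := covariance_matCLM_eq_zero hSx hA v
    (ℓ.comp (ContinuousLinearMap.inl ℝ (E p) (E p)))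
  have zB := covariance_matCLM_eq_zero hSx hB v
    (ℓ.comp (ContinuousLinearMap.inr ℝ (E p) (E p)))
  exact (congrArg₂ (· + ·) zA zB).trans (add_zero 0)

/-- Every linear policy has a linear posterior mean. -/
lemma exists_linear_estimator (hSx : Sx.PosSemidef) (A : Matrix (Fin p) (Fin p) ℝ) :
    ∃ G : Matrix (Fin p) (Fin p) ℝ, (1 - G * A) * Sx * Aᵀ = 0 := by
  set H := psdSqrt Sx
  set N := A * Sx * Aᵀ with hN
  have hNp : N.PosSemidef := posSemidef_conj hSx A
  have r := isRootPair hSx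
  have r' := isRootPair hNp
  set h := psdSqrt N
  set g := symPinv h
  -- The regression coefficient Σ Aᵀ (A Σ Aᵀ)†; `g * g` plays the pseudo-inverse, so A may be
  -- singular.
  refine ⟨Sx * Aᵀ * (g * g), ?_⟩
  have h1 : N * (g * g) * N = N := by
    calc N * (g * g) * N = h * (h * g * (g * h)) * h := by
          rw [← r'.sq]; simp only [Matrix.mul_assoc]
      _ = h * (h * g * h * g) * h := by rw [← r'.comm]; simp only [Matrix.mul_assoc]
      _ = h * (h * g * h) := by rw [r'.left, Matrix.mul_assoc h (h * g), r'.left]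
      _ = N := by rw [r'.left, r'.sq]
  set K := 1 - g * g * N with hK
  have h2 : N * K = 0 := by rw [hK, Matrix.mul_sub, ← Matrix.mul_assoc, h1]; simp
  -- The squared Frobenius norm of H Aᵀ K is the trace of Kᵀ N K, and N K = 0.
  have h3 : H * Aᵀ * K = 0 := by
    rw [← trace_conjTranspose_mul_self_eq_zero_iff]
    have : (H * Aᵀ * K)ᴴ * (H * Aᵀ * K) = Kᵀ * (A * (H * H) * Aᵀ * K) := by
      simp [transpose_mul, Matrix.mul_assoc, show Hᵀ = H from r.symm]
    rw [this, show H * H = Sx from r.sq, ← hN, h2]; simp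
  have h4 : (1 - Sx * Aᵀ * (g * g) * A) * Sx * Aᵀ = H * (H * Aᵀ * K) := by
    rw [Matrix.mul_assoc H Aᵀ, ← Matrix.mul_assoc H H, show H * H = Sx from r.sq, hK, hN]
    simp only [Matrix.mul_sub, Matrix.sub_mul, Matrix.mul_one, Matrix.one_mul, Matrix.mul_assoc]
  rw [h4, h3, Matrix.mul_zero]

end LinearPosterior

/-! ### One step of the algorithm as a semidefinite minimization. -/

section Algorithm

variable {p : ℕ} {Sx V S S' : Matrix (Fin p) (Fin p) ℝ}

lemma conj_symm {H V : Matrix (Fin p) (Fin p) ℝ} (hH : Hᵀ = H) (hV : Vᵀ = V) :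
    (H * V * H)ᵀ = H * V * H := by
  simp only [transpose_mul, hH, hV, Matrix.mul_assoc]

lemma trace_conj (V H T : Matrix (Fin p) (Fin p) ℝ) :
    (V * (H * T * H)).trace = (H * V * H * T).trace := by
  rw [← Matrix.mul_assoc, trace_mul_comm]
  simp only [Matrix.mul_assoc]

lemma exists_algorithmStep (hV : Vᵀ = V) (hS : (Sx - S).PosSemidef) :
    ∃ S', AlgorithmStep Sx V S S' := by
  obtain ⟨P, -, -, -, r, Q, hQ⟩ := exists_negProj (conj_symm (isRootPair hS).symm hV)
  exact ⟨_, r, Q, hQ, rfl⟩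

/-- The data of one step of the algorithm: `H = (Sx - S)^{1/2}`, its pseudo-inverse `G`, and the
projection `P` on the negative eigenspaces of `H V H`. -/
structure StepData (Sx V S S' H G P : Matrix (Fin p) (Fin p) ℝ) : Prop where
  root : IsRootPair (Sx - S) H G
  proj : IsNegProj (H * V * H) P
  eq : S' = S + H * P * H
  left : H * G * P = P

lemma AlgorithmStep.stepData (hV : Vᵀ = V) (hS : (Sx - S).PosSemidef)
    (h : AlgorithmStep Sx V S S') :
    ∃ P, StepData Sx V S S' (psdSqrt (Sx - S)) (symPinv (psdSqrt (Sx - S))) P := by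
  obtain ⟨r, Q, hQ, hS'⟩ := h
  have hr := isRootPair hS
  have hW := conj_symm hr.symm hV
  have hP := isNegProj_of_eigenbasis hW hQ
  refine ⟨_, hr, hP, hS', ?_⟩
  -- As P = H V H Y, its range lies in that of H, where H G is the identity.
  obtain ⟨Y, hY⟩ := hP.factor' hW
  rw [hY]
  simp only [← Matrix.mul_assoc]
  rw [hr.left]

namespace StepData

variable {H G P : Matrix (Fin p) (Fin p) ℝ}

lemma right (h : StepData Sx V S S' H G P) : P * G * H = P := by
  have := congrArg transpose h.left
  rwa [transpose_mul, transpose_mul, h.root.symm, h.root.symm', h.proj.symm,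
    ← Matrix.mul_assoc] at this

lemma left' (h : StepData Sx V S S' H G P) : G * H * P = P := by
  rw [← h.root.comm, h.left]

lemma right' (h : StepData Sx V S S' H G P) : P * H * G = P := by
  rw [Matrix.mul_assoc, h.root.comm, ← Matrix.mul_assoc, h.right]

lemma sub_posSemidef (h : StepData Sx V S S' H G P) : (S' - S).PosSemidef := by
  rw [h.eq, add_sub_cancel_left]
  simpa [h.root.symm] using posSemidef_conj (posSemidef_of_idem h.proj.symm h.proj.idem) H

lemma gap_eq (h : StepData Sx V S S' H G P) : Sx - S' = H * (1 - P) * H := by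
  rw [h.eq, Matrix.mul_sub, Matrix.sub_mul, Matrix.mul_one, h.root.sq]
  abel

lemma gap_posSemidef (h : StepData Sx V S S' H G P) : (Sx - S').PosSemidef := by
  rw [h.gap_eq]
  simpa [h.root.symm] using posSemidef_conj (posSemidef_one_sub h.proj.symm h.proj.idem) H

/-- A step minimizes the trace objective above the current posterior. -/
lemma trace_le (h : StepData Sx V S S' H G P) {T : Matrix (Fin p) (Fin p) ℝ}
    (hT : (Sx - T).PosSemidef) (hST : (T - S).PosSemidef) :
    (V * S').trace ≤ (V * T).trace := by
  have hle : (Sx - S - (T - S)).PosSemidef := by rwa [sub_sub_sub_cancel_right]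
  have h1 := h.root.compress hST hle
  have h2 := h.proj.trace_le (h.root.compress_posSemidef hST) (h.root.one_sub_compress hle)
  rw [← trace_conj, ← trace_conj, h1, Matrix.mul_sub, trace_sub] at h2
  rw [h.eq, Matrix.mul_add, trace_add]
  linarith

/-- After a step, revealing more does not lower the trace objective. -/
lemma trace_nonneg (h : StepData Sx V S S' H G P) {N : Matrix (Fin p) (Fin p) ℝ}
    (hN : N.PosSemidef) (hN' : (Sx - S' - N).PosSemidef) : 0 ≤ (V * N).trace := by
  have hle : (Sx - S - N).PosSemidef := by
    have := hN'.add h.sub_posSemidef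
    rwa [show Sx - S' - N + (S' - S) = Sx - S - N by abel] at this
  have h1 := h.root.compress hN hle
  have h2 := h.root.compress_posSemidef hN
  have h3 : (G * (Sx - S') * G - G * N * G).PosSemidef := by
    have := h.root.compress_posSemidef hN'
    rwa [Matrix.mul_sub, Matrix.sub_mul] at this
  -- The uncertainty left is H(1 - P)H; its compression annihilates P, and so does that of every N
  -- below it.
  have h4 : G * (Sx - S') * G * P = 0 := by
    calc G * (Sx - S') * G * P = G * H * (1 - P) * (H * G * P) := by
          rw [h.gap_eq]; simp only [Matrix.mul_assoc]
      _ = 0 := by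
          rw [h.left, Matrix.mul_assoc, Matrix.sub_mul, h.proj.idem, Matrix.one_mul, sub_self,
            Matrix.mul_zero]
  have h5 := mul_eq_zero_of_le h2 h3 h4
  have h6 : P * (G * N * G) = 0 := by
    have := congrArg transpose h5
    rwa [transpose_mul, h.proj.symm, PosSemidef.symm h2, transpose_zero] at this
  have h7 := trace_mul_nonneg h.proj.pos h2
  rwa [Matrix.mul_sub, Matrix.mul_one, Matrix.sub_mul, Matrix.mul_assoc _ P, h6, Matrix.mul_zero,
    sub_zero, ← trace_conj, h1] at h7

lemma rank_le (h : StepData Sx V 0 S' H G P) : S'.rank ≤ P.rank := by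
  rw [h.eq, zero_add]
  exact (rank_mul_le_left _ _).trans (rank_mul_le_right _ _)

lemma compress_facts (h : StepData Sx V 0 S' H G P) {T : Matrix (Fin p) (Fin p) ℝ}
    (hT0 : T.PosSemidef) (hT : (Sx - T).PosSemidef) (hle : (V * T).trace ≤ (V * S').trace) :
    H * (G * T * G) * H = T ∧ (1 - G * T * G).PosSemidef ∧
      (H * V * H * (G * T * G)).trace ≤ (H * V * H * P).trace := by
  have hT' : (Sx - 0 - T).PosSemidef := by rwa [sub_zero]
  have h1 := h.root.compress hT0 hT'
  refine ⟨h1, h.root.one_sub_compress hT', ?_⟩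
  rw [← trace_conj, ← trace_conj, h1]
  rwa [h.eq, zero_add] at hle

/-- The compression X = G T G of a minimizer satisfies P X = P, which bounds its rank from below. -/
lemma rank_le_of_minimizer (h : StepData Sx V 0 S' H G P) {T : Matrix (Fin p) (Fin p) ℝ}
    (hT0 : T.PosSemidef) (hT : (Sx - T).PosSemidef) (hle : (V * T).trace ≤ (V * S').trace) :
    S'.rank ≤ T.rank := by
  obtain ⟨-, h2, h3⟩ := h.compress_facts hT0 hT hle
  have h4 := h.proj.mul_eq_of_trace (h.root.compress_posSemidef hT0) h2 h3
  have h5 : P.rank ≤ (G * T * G).rank := by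
    conv_lhs => rw [← h4]
    exact rank_mul_le_right _ _
  exact h.rank_le.trans (h5.trans ((rank_mul_le_left _ _).trans (rank_mul_le_right _ _)))

lemma eq_of_minimizer_of_rank (h : StepData Sx V 0 S' H G P) {T : Matrix (Fin p) (Fin p) ℝ}
    (hT0 : T.PosSemidef) (hT : (Sx - T).PosSemidef) (hle : (V * T).trace ≤ (V * S').trace)
    (hr : T.rank ≤ S'.rank) : T = S' := by
  obtain ⟨h1, h2, h3⟩ := h.compress_facts hT0 hT hle
  have h4 := h.proj.eq_of_trace_of_rank (h.root.compress_posSemidef hT0) h2 h3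
    (((rank_mul_le_left _ _).trans (rank_mul_le_right _ _)).trans (hr.trans h.rank_le))
  rw [← h1, h4, h.eq, zero_add]

/-- The projection is recovered from the two posteriors. -/
lemma pinv_conj_eq (h : StepData Sx V S S' H G P) : G * (S' - S) * G = P := by
  calc G * (S' - S) * G = G * H * P * H * G := by
        rw [h.eq, add_sub_cancel_left]; simp only [Matrix.mul_assoc]
    _ = P := by rw [h.left', h.right']

/-- Revealing the components selected by the projection attains the posterior of the step. -/
lemma posteriorCov_first (hSx : Sx.PosDef) (h : StepData Sx V 0 S' H G P)
    {U : Matrix (Fin p) (Fin p) ℝ} (hU : U * Uᵀ = 1) :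
    posteriorCov Sx (linearPolicy (Uᵀ * P * G)) = S' := by
  have hHH : H * H = Sx := by rw [h.root.sq, sub_zero]
  -- The rotation U only changes coordinates in the signal. The estimator `H * U` undoes it and
  -- returns H P G x.
  have hA : H * U * (Uᵀ * P * G) = H * P * G := by
    calc H * U * (Uᵀ * P * G) = H * (U * Uᵀ) * P * G := by simp only [Matrix.mul_assoc]
      _ = H * P * G := by rw [hU, Matrix.mul_one]
  have h1 : H * P * G * Sx = H * P * H := by
    rw [← hHH]
    calc H * P * G * (H * H) = H * (P * G * H) * H := by simp only [Matrix.mul_assoc]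
      _ = H * P * H := by rw [h.right]
  rw [posteriorCov_linearPolicy hSx.posSemidef (G := H * U), hA, h1, h.eq, zero_add]
  rw [hA, Matrix.sub_mul, h1, Matrix.one_mul, ← hHH]
  calc (H * H - H * P * H) * (Uᵀ * P * G)ᵀ = H * (1 - P) * (H * G * P) * U := by
        simp only [transpose_mul, transpose_transpose, h.root.symm', h.proj.symm, Matrix.mul_sub,
          Matrix.sub_mul, Matrix.mul_assoc, Matrix.one_mul]
    _ = 0 := by
        rw [h.left, Matrix.mul_assoc H, Matrix.sub_mul, h.proj.idem, Matrix.one_mul, sub_self]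
        simp

/-- If a linear policy has posterior covariance `S`, then revealing in addition the components
selected by the projection attains the posterior of the step. -/
lemma posteriorCov_after (hSx : Sx.PosSemidef) (h : StepData Sx V S S' H G P)
    {A U : Matrix (Fin p) (Fin p) ℝ} (hA : posteriorCov Sx (linearPolicy A) = S)
    (hU : U * Uᵀ = 1) :
    posteriorCov Sx (obsAfter (linearPolicy A) (linearPolicy (Uᵀ * P * G))) = S' := by
  obtain ⟨F, hF⟩ := exists_linear_estimator hSx A
  have hS : F * A * Sx = S := by rw [← hA, posteriorCov_linearPolicy hSx hF]
  set B := Uᵀ * P * G with hB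
  set K := H * P * U with hK
  have hKB : K * B = H * P * G := by
    calc K * B = H * P * (U * Uᵀ) * P * G := by simp only [hK, hB, Matrix.mul_assoc]
      _ = H * (P * P) * G := by rw [hU, Matrix.mul_one, Matrix.mul_assoc H]
      _ = H * P * G := by rw [h.proj.idem]
  -- Sequential update: estimate by F A x, then correct by K times the innovation B(x - F A x). The
  -- error factors, and (1 - F A)Σ = Σ - S = H H is the error covariance left by the first signal.
  have hT : 1 - ((F - K * B * F) * A + K * B) = (1 - K * B) * (1 - F * A) := by noncomm_ring
  have hD : (1 - F * A) * Sx = H * H := by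
    rw [Matrix.sub_mul, Matrix.one_mul, hS, h.root.sq]
  have hBt : Bᵀ = G * P * U := by
    rw [hB]
    simp only [transpose_mul, transpose_transpose, h.root.symm', h.proj.symm, Matrix.mul_assoc]
  have hKBD : K * B * (H * H) = H * P * H := by
    rw [hKB]
    calc H * P * G * (H * H) = H * (P * G * H) * H := by simp only [Matrix.mul_assoc]
      _ = H * P * H := by rw [h.right]
  rw [posteriorCov_obsAfter hSx (G := F - K * B * F) (K := K)]
  · have e : (F - K * B * F) * A + K * B = F * A + K * B * (1 - F * A) := by noncomm_ring
    rw [e, Matrix.add_mul, hS, Matrix.mul_assoc, hD, hKBD, h.eq]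
  · rw [hT, Matrix.mul_assoc, Matrix.mul_assoc, ← Matrix.mul_assoc (1 - F * A), hF,
      Matrix.mul_zero]
  · rw [hT, Matrix.mul_assoc _ _ Sx, hD, Matrix.sub_mul, hKBD, Matrix.one_mul, hBt]
    calc (H * H - H * P * H) * (G * P * U) = H * (1 - P) * (H * G * P) * U := by
          simp only [Matrix.mul_sub, Matrix.sub_mul, Matrix.mul_assoc, Matrix.one_mul]
      _ = 0 := by
          rw [h.left, Matrix.mul_assoc H, Matrix.sub_mul, h.proj.idem, Matrix.one_mul, sub_self]
          simp

end StepData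

end Algorithm

/-! ### Equilibria of the base game. -/

section Game

variable {p q t : ℕ} {Sx : Matrix (Fin p) (Fin p) ℝ}

lemma costMatrix_transpose (Q : Matrix (Fin q) (Fin p) ℝ) (R : Matrix (Fin q) (Fin t) ℝ)
    (Qr : Matrix (Fin q) (Fin p) ℝ) (Rr : Matrix (Fin q) (Fin t) ℝ) :
    (costMatrix Q R Qr Rr)ᵀ = costMatrix Q R Qr Rr := by
  simp only [costMatrix]
  generalize R * (Rrᵀ * Rr)⁻¹ * Rrᵀ * Qr = L
  simp only [transpose_sub, transpose_mul, transpose_transpose]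
  abel

variable {Q : Matrix (Fin q) (Fin p) ℝ} {R : Matrix (Fin q) (Fin t) ℝ}
  {Qr : Matrix (Fin q) (Fin p) ℝ} {Rr : Matrix (Fin q) (Fin t) ℝ}
  {S' H G P : Matrix (Fin p) (Fin p) ℝ}

lemma measurable_obsAfter {η₁ η : E p → E p} (h₁ : Measurable η₁) (h : Measurable η) :
    Measurable (obsAfter η₁ η) := h₁.prodMk h

/-- The step is optimal over all matrices between 0 and Σ, a set containing every posterior
covariance, so attaining it is enough. -/
lemma StepData.isStackelberg_of_posteriorCov (hSx : Sx.PosSemidef) (hRr : IsUnit (Rrᵀ * Rr))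
    (h : StepData Sx (costMatrix Q R Qr Rr) 0 S' H G P) {η : E p → E p}
    {γ : (E p → E p) → E p → E t} (hη : Measurable η) (hc : posteriorCov Sx η = S')
    (hγ : IsReceiverReaction Sx Qr Rr obsSingle γ) :
    IsStackelberg Sx Q R Qr Rr obsSingle η γ := by
  refine (isStackelberg_iff hSx hRr fun _ h => h).2 ⟨hη, hγ, fun η' hη' => ?_⟩
  rw [hc]
  exact h.trace_le (posteriorCov_le hSx hη') (by rw [sub_zero]; exact posteriorCov_posSemidef _)

lemma StepData.isBaseEquilibrium_of_posteriorCov (hSx : Sx.PosSemidef) (hRr : IsUnit (Rrᵀ * Rr))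
    (h : StepData Sx (costMatrix Q R Qr Rr) 0 S' H G P) {η : E p → E p}
    {γ : (E p → E p) → E p → E t} (hη : Measurable η) (hc : posteriorCov Sx η = S')
    (hγ : IsReceiverReaction Sx Qr Rr obsSingle γ) :
    IsBaseEquilibrium Sx Q R Qr Rr η γ := by
  refine ⟨h.isStackelberg_of_posteriorCov hSx hRr hη hc hγ, fun η' hη' => ?_⟩
  have h1 := ((isStackelberg_iff hSx hRr fun _ h => h).1 hη').2.2 η hη
  rw [hc] at h1
  rw [hc]
  exact h.rank_le_of_minimizer (posteriorCov_posSemidef _) (posteriorCov_le hSx hη'.measurable) h1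

/-- All equilibria of the base game have the posterior computed by the algorithm. -/
lemma StepData.posteriorCov_of_isBaseEquilibrium (hSx : Sx.PosDef) (hRr : IsUnit (Rrᵀ * Rr))
    (h : StepData Sx (costMatrix Q R Qr Rr) 0 S' H G P) {η : E p → E p}
    {γ : (E p → E p) → E p → E t} (hη : IsBaseEquilibrium Sx Q R Qr Rr η γ) :
    posteriorCov Sx η = S' := by
  -- This linear competitor attains S' and is an equilibrium for the same reaction, so the given one
  -- can exceed it neither in trace nor in rank.
  have hm := measurable_linearPolicy (1ᵀ * P * G)
  have hc := h.posteriorCov_first hSx (U := 1) (by simp)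
  have h1 := ((isStackelberg_iff hSx.posSemidef hRr fun _ h => h).1 hη.stackelberg).2.2 _ hm
  have h2 := hη.least_rank _
    (h.isStackelberg_of_posteriorCov hSx.posSemidef hRr hm hc hη.stackelberg.reaction)
  rw [hc] at h1
  rw [hc] at h2
  exact h.eq_of_minimizer_of_rank (posteriorCov_posSemidef _)
    (posteriorCov_le hSx.posSemidef hη.stackelberg.measurable) h1 h2

end Game

end SenderGame

/-! ### Assembly of the theorem. -/

theorem theorem2 {p q t : ℕ}
    (Sx : Matrix (Fin p) (Fin p) ℝ) (hSx : Sx.PosDef)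
    (Q₁ Q₂ Qr : Matrix (Fin q) (Fin p) ℝ) (R₁ R₂ Rr : Matrix (Fin q) (Fin t) ℝ)
    (hRr : IsUnit (Rrᵀ * Rr)) :
    -- the algorithm can be run
    (∃ S₁ S, SenderGame.AlgorithmRun Sx (SenderGame.costMatrix Q₁ R₁ Qr Rr)
      (SenderGame.costMatrix Q₂ R₂ Qr Rr) S₁ S) ∧
    ∀ S₁ S : Matrix (Fin p) (Fin p) ℝ,
      SenderGame.AlgorithmRun Sx (SenderGame.costMatrix Q₁ R₁ Qr Rr)
        (SenderGame.costMatrix Q₂ R₂ Qr Rr) S₁ S →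
      -- its output is stable for both senders
      SenderGame.IsStable Sx (SenderGame.costMatrix Q₁ R₁ Qr Rr) S ∧
      SenderGame.IsStable Sx (SenderGame.costMatrix Q₂ R₂ Qr Rr) S ∧
      -- the base game has the linear equilibrium `Aᵀ = Sx^{-1/2} U Λ`
      (∀ (U : Matrix (Fin p) (Fin p) ℝ) (l : Fin p → ℝ),
        U ∈ Matrix.orthogonalGroup (Fin p) ℝ →
        (SenderGame.psdSqrt Sx)⁻¹ * S₁ * (SenderGame.psdSqrt Sx)⁻¹
          = U * Matrix.diagonal l * Uᵀ →
        ∃ γ₁ : (SenderGame.E p → SenderGame.E p) → SenderGame.E p → SenderGame.E t,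
          SenderGame.IsBaseEquilibrium Sx Q₁ R₁ Qr Rr
            (SenderGame.linearPolicy ((SenderGame.psdSqrt Sx)⁻¹ * U * Matrix.diagonal l)ᵀ) γ₁) ∧
      -- the base-game equilibrium posterior is `C₁ = S₁`, and `Pt` is an orthogonal projection
      ∀ (η₁ : SenderGame.E p → SenderGame.E p)
        (γ₁ : (SenderGame.E p → SenderGame.E p) → SenderGame.E p → SenderGame.E t)
        (C₁ Pt : Matrix (Fin p) (Fin p) ℝ),
        SenderGame.IsBaseEquilibrium Sx Q₁ R₁ Qr Rr η₁ γ₁ →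
        C₁ = SenderGame.posteriorCov Sx η₁ →
        Pt = SenderGame.symPinv (SenderGame.psdSqrt (Sx - C₁)) * (S - C₁) *
          SenderGame.symPinv (SenderGame.psdSqrt (Sx - C₁)) →
        C₁ = S₁ ∧
        (Ptᵀ = Pt ∧ Pt * Pt = Pt) ∧
        S = C₁ + SenderGame.psdSqrt (Sx - C₁) * Pt * SenderGame.psdSqrt (Sx - C₁) ∧
        -- the receiver has a best response to every policy of sender 2
        (∃ γ : (SenderGame.E p → SenderGame.E p) → SenderGame.E p × SenderGame.E p →
            SenderGame.E t,
          SenderGame.IsReceiverReaction Sx Qr Rr (SenderGame.obsAfter η₁) γ) ∧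
        -- if sender 1 has committed to a linear policy `x ↦ A x`, then
        -- `Bᵀ = (Sx - C₁)^{†1/2} U Λ` gives an equilibrium with posterior covariance `S`
        ∀ (A U B : Matrix (Fin p) (Fin p) ℝ) (l : Fin p → ℝ),
          η₁ = SenderGame.linearPolicy A →
          U ∈ Matrix.orthogonalGroup (Fin p) ℝ →
          Pt = U * Matrix.diagonal l * Uᵀ →
          Bᵀ = SenderGame.symPinv (SenderGame.psdSqrt (Sx - C₁)) * U * Matrix.diagonal l →
          (∀ γ : (SenderGame.E p → SenderGame.E p) → SenderGame.E p × SenderGame.E p →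
              SenderGame.E t,
            SenderGame.IsReceiverReaction Sx Qr Rr (SenderGame.obsAfter η₁) γ →
            SenderGame.IsStackelberg Sx Q₂ R₂ Qr Rr (SenderGame.obsAfter η₁)
              (SenderGame.linearPolicy B) γ) ∧
          SenderGame.posteriorCov Sx
            (SenderGame.obsAfter η₁ (SenderGame.linearPolicy B)) = S := by
  have hS := hSx.posSemidef
  have h0 : (Sx - 0).PosSemidef := by rwa [sub_zero]
  have hV₁ := SenderGame.costMatrix_transpose Q₁ R₁ Qr Rr
  have hV₂ := SenderGame.costMatrix_transpose Q₂ R₂ Qr Rr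
  constructor
  · obtain ⟨S₁, h₁⟩ := SenderGame.exists_algorithmStep hV₁ h0
    obtain ⟨P₁, d₁⟩ := h₁.stepData hV₁ h0
    obtain ⟨S, h₂⟩ := SenderGame.exists_algorithmStep hV₂ d₁.gap_posSemidef
    exact ⟨S₁, S, h₁, h₂⟩
  rintro S₁ S ⟨h₁, h₂⟩
  obtain ⟨P₁, d₁⟩ := h₁.stepData hV₁ h0
  obtain ⟨P₂, d₂⟩ := h₂.stepData hV₂ d₁.gap_posSemidef
  have hS₁ : S₁.PosSemidef := by simpa using d₁.sub_posSemidef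
  have hSp : S.PosSemidef := by simpa using d₂.sub_posSemidef.add hS₁
  refine ⟨⟨hSp, d₂.gap_posSemidef, fun T hT hST => ?_⟩,
    ⟨hSp, d₂.gap_posSemidef, fun T hT hST => d₂.trace_le hT ?_⟩, fun U l hU hUl => ?_, ?_⟩
  -- For sender 1: as S ⪰ S₁, the extra revelation T - S fits in the gap left by its own step.
  · have hle : (Sx - S₁ - (T - S)).PosSemidef := by
      have := hT.add d₂.sub_posSemidef
      rwa [show Sx - T + (S - S₁) = Sx - S₁ - (T - S) by abel] at this
    have := d₁.trace_nonneg hST hle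
    rw [Matrix.mul_sub, trace_sub] at this
    linarith
  · simpa using hST.add d₂.sub_posSemidef
  · obtain ⟨hU₁, hU₂⟩ := (Matrix.mem_orthogonalGroup_iff' (Fin p) ℝ).1 hU,
      (Matrix.mem_orthogonalGroup_iff (Fin p) ℝ).1 hU
    rw [sub_zero] at d₁
    have hHG := d₁.root
    set H := SenderGame.psdSqrt Sx
    set G := SenderGame.symPinv H
    have hHH : H * H = Sx := by rw [hHG.sq, sub_zero]
    -- Positive definiteness makes H invertible, so its inverse agrees with the pseudo-inverse of
    -- the step.
    have hHu : IsUnit H.det := by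
      have := (isUnit_iff_isUnit_det _).1 hSx.isUnit
      rw [← hHH, det_mul] at this
      exact isUnit_of_mul_isUnit_left this
    have hGi : H⁻¹ = G := by
      have := congrArg (H⁻¹ * ·) hHG.left
      simp only [← Matrix.mul_assoc, nonsing_inv_mul _ hHu, Matrix.one_mul] at this
      exact inv_eq_left_inv this
    have hP : P₁ = U * diagonal l * Uᵀ := by
      rw [← hUl, hGi]; simpa using d₁.pinv_conj_eq.symm
    have hA : (H⁻¹ * U * diagonal l)ᵀ = Uᵀ * P₁ * G := by
      have : P₁ * U = U * diagonal l := by rw [hP, Matrix.mul_assoc, hU₁, Matrix.mul_one]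
      rw [hGi, Matrix.mul_assoc, ← this]
      simp only [transpose_mul, hHG.symm', d₁.proj.symm]
    rw [hA]
    obtain ⟨γ, hγ⟩ := SenderGame.exists_reaction (Sx := Sx) (Qr := Qr) hRr
      SenderGame.obsSingle fun _ h => h
    exact ⟨γ, d₁.isBaseEquilibrium_of_posteriorCov hS hRr
      (SenderGame.measurable_linearPolicy _) (d₁.posteriorCov_first hSx hU₂) hγ⟩
  intro η₁ γ₁ C₁ Pt heq hC hPt
  have hC₁ : C₁ = S₁ := hC.trans (d₁.posteriorCov_of_isBaseEquilibrium hSx hRr heq)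
  have hη₁ := heq.stackelberg.measurable
  subst hC₁
  have hPt' : Pt = P₂ := hPt.trans d₂.pinv_conj_eq
  subst hPt'
  refine ⟨rfl, ⟨d₂.proj.symm, d₂.proj.idem⟩, d₂.eq,
    SenderGame.exists_reaction hRr _ fun _ => SenderGame.measurable_obsAfter hη₁, ?_⟩
  intro A U B l hA hU hUl hB
  obtain ⟨hU₁, hU₂⟩ := (Matrix.mem_orthogonalGroup_iff' (Fin p) ℝ).1 hU,
    (Matrix.mem_orthogonalGroup_iff (Fin p) ℝ).1 hU
  have hB' : B = Uᵀ * Pt * SenderGame.symPinv (SenderGame.psdSqrt (Sx - C₁)) := by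
    have : Pt * U = U * diagonal l := by rw [hUl, Matrix.mul_assoc, hU₁, Matrix.mul_one]
    rw [← transpose_transpose B, hB, Matrix.mul_assoc, ← this]
    simp only [transpose_mul, d₂.root.symm', d₂.proj.symm]
  have hcov : SenderGame.posteriorCov Sx
      (SenderGame.obsAfter η₁ (SenderGame.linearPolicy B)) = S := by
    rw [hB', hA]
    exact d₂.posteriorCov_after hS (by rw [← hA, ← hC]) hU₂
  refine ⟨fun γ hγ => (SenderGame.isStackelberg_iff hS hRr
    fun _ => SenderGame.measurable_obsAfter hη₁).2
    ⟨SenderGame.measurable_linearPolicy B, hγ, fun η' hη' => ?_⟩, hcov⟩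
  have hm := SenderGame.measurable_obsAfter hη₁ hη'
  rw [hcov]
  -- The pair of signals refines the first one, so every reachable posterior is feasible for the
  -- second step.
  refine d₂.trace_le (SenderGame.posteriorCov_le hS hm) ?_
  rw [hC]
  exact SenderGame.posteriorCov_mono hη₁ hm
    (measurable_fst.comp (comap_measurable (SenderGame.obsAfter η₁ η'))).comap_le
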